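/- Let $q$ be a prime power and let $\mathbb F_q$ be the field with $q$ elements. Index the coordinates of vectors over $\mathbb F_q$ in the order $$x_1,\ x_{11},\ x_{12},\ x_{21},\ x_{22},\ x'_{22},\ x_{23},\ x_{32},\ \dots,\ x_{ii},\ x'_{ii},\ x_{i,i+1},\ x_{i+1,i},\ \dots$$ For $k\ge 2$ let $D(k,q)$ be the bipartite graph whose vertices are the points $(p)$ and the lines $[l]$, where $(p)$ and $[l]$ range over two disjoint copies of $\mathbb F_q^k$ (the first $k$ coordinates in the order above), and in which $(p)$ and $[l]$ are adjacent if and only if the first $k-1$ of the following relations hold: $$l_{11}-p_{11}=l_1p_1,\qquad l_{12}-p_{12}=l_{11}p_1,\qquad l_{21}-p_{21}=l_1p_{11},$$ and, for $i=2,3,\dots$ successively, $$l_{ii}-p_{ii}=l_1p_{i-1,i},\quad l'_{ii}-p'_{ii}=l_{i,i-1}p_1,\quad l_{i,i+1}-p_{i,i+1}=l_{ii}p_1,\quad l_{i+1,i}-p_{i+1,i}=l_1p'_{ii}.$$ Put $D(1,q)=D(2,q)$. Let $k\ge 1$, $t=\lfloor\frac{k+2}{4}\rfloor$ and $\kappa=\max(k,2)$,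 so that $\kappa=k$ unless $k=1$. Let $N_{k,q}$ be the number of connected components of $D(k,q)$, let $CD(k,q)$ be any connected component of $D(k,q)$, and let $v$ and $e$ be its numbers of vertices and edges. Then: (i) $CD(k,q)$ is a bipartite, connected, $q$-regular graph of order $v=\dfrac{2q^{\kappa}}{N_{k,q}}\le 2q^{k-t+1}$. (ii) The automorphism group of the graph $CD(k,q)$ acts transitively on its points, on its lines, and on its edges. (iii) If $k$ is odd, then $CD(k,q)$ contains a cycle and its girth is at least $k+5$; if moreover $q\equiv 1\pmod{\frac{k+5}{2}}$, its girth equals $k+5$. (iv) $e=\dfrac{vq}{2}=2^{-1-\frac1\kappa}\,N_{k,q}^{\frac1\kappa}\,v^{1+\frac1\kappa}$. -/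

import Mathlib

namespace LazebnikUstimenko

/-- The right-hand side of the incidence relation for the coordinate in position `n` (counted
from `0`), for a line `l` and a point `p`. The coordinates of a vector are listed in the order
`x_1, x_11, x_12, x_21, x_22, x'_22, x_23, x_32, …, x_ii, x'_ii, x_{i,i+1}, x_{i+1,i}, …`, so that
for `i = j + 2` the positions of `x_ii, x'_ii, x_{i,i+1}, x_{i+1,i}` are
`4 j + 4, 4 j + 5, 4 j + 6, 4 j + 7`. Position `0` carries no relation (junk value `0`). -/
def rhs {F : Type*} [Field F] (l p : ℕ → F) : ℕ → F
  | 0 => 0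
  | 1 => l 0 * p 0 -- l_11 - p_11 = l_1 p_1
  | 2 => l 1 * p 0 -- l_12 - p_12 = l_11 p_1
  | 3 => l 0 * p 1 -- l_21 - p_21 = l_1 p_11
  | m + 4 =>
    match m % 4 with
    | 0 => l 0 * p (m + 2) -- l_ii - p_ii = l_1 p_{i-1,i}
    | 1 => l (m + 2) * p 0 -- l'_ii - p'_ii = l_{i,i-1} p_1
    | 2 => l (m + 2) * p 0 -- l_{i,i+1} - p_{i,i+1} = l_ii p_1
    | _ => l 0 * p (m + 2) -- l_{i+1,i} - p_{i+1,i} = l_1 p'_ii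

/-- Extension of a vector of length `n` by zeros. -/
def extend {F : Type*} [Field F] {n : ℕ} (x : Fin n → F) : ℕ → F :=
  fun m => if h : m < n then x ⟨m, h⟩ else 0

/-- Incidence of the point `p` and the line `l`, both with `n` coordinates: the first `n - 1`
incidence relations hold. (The relation in position `m` only involves positions `≤ m`.) -/
def Incident {F : Type*} [Field F] {n : ℕ} (p l : Fin n → F) : Prop :=
  ∀ m : ℕ, 1 ≤ m → m < n → extend l m - extend p m = rhs (extend l) (extend p) m

/-- The number of coordinates of the points and lines of `D(k, q)`:
it is `k` for `k ≥ 2`, and `D(1, q)` is by convention `D(2, q)`. -/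
def numCoords (k : ℕ) : ℕ := max k 2

/-- The vertices of `D(k, q)`: `Sum.inl p` is the point `(p)`, `Sum.inr l` is the line `[l]`. -/
abbrev Vertex (k : ℕ) (F : Type*) : Type _ :=
  (Fin (numCoords k) → F) ⊕ (Fin (numCoords k) → F)

/-- The graph `D(k, q)`, where `F` is the field with `q` elements. -/
def D (k : ℕ) (F : Type*) [Field F] : SimpleGraph (Vertex k F) where
  Adj
    | Sum.inl p, Sum.inr l => Incident p l
    | Sum.inr l, Sum.inl p => Incident p l
    | _, _ => False
  symm := ⟨by rintro (x | x) (y | y) h <;> exact h⟩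
  loopless := ⟨by rintro (x | x) h <;> exact h⟩

/-- `N_{k,q}`, the number of connected components of `D(k, q)`. -/
noncomputable def numComponents (k : ℕ) (F : Type*) [Field F] : ℕ :=
  Nat.card (D k F).ConnectedComponent

/-- `CD(k, q)`: the subgraph of `D(k, q)` induced on a connected component `C`. -/
abbrev CD {k : ℕ} {F : Type*} [Field F] (C : (D k F).ConnectedComponent) :
    SimpleGraph C :=
  C.toSimpleGraph

/-- The order of a graph. -/
noncomputable def order {V : Type*} (_G : SimpleGraph V) : ℕ := Nat.card V

/-- The size of a graph, its number of edges. -/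
noncomputable def size {V : Type*} (G : SimpleGraph V) : ℕ := Nat.card G.edgeSet

/-- The automorphism group of `G` acts transitively on the set `S` of vertices. -/
def AutTransitiveOn {V : Type*} (G : SimpleGraph V) (S : Set V) : Prop :=
  ∀ x ∈ S, ∀ y ∈ S, ∃ φ : G ≃g G, φ x = y

/-- The automorphism group of `G` acts transitively on the edges. -/
def AutEdgeTransitive {V : Type*} (G : SimpleGraph V) : Prop :=
  ∀ e ∈ G.edgeSet, ∀ f ∈ G.edgeSet, ∃ φ : G ≃g G, Sym2.map φ e = f

/-- The points of the component `C`. -/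
def points {k : ℕ} {F : Type*} [Field F] (C : (D k F).ConnectedComponent) : Set C :=
  {x | ∃ p, (x : Vertex k F) = Sum.inl p}

/-- The lines of the component `C`. -/
def lines {k : ℕ} {F : Type*} [Field F] (C : (D k F).ConnectedComponent) : Set C :=
  {x | ∃ l, (x : Vertex k F) = Sum.inr l}

end LazebnikUstimenko

/-!
Everything rests on a matrix model. The coordinates of a vertex are collected into a `2 × 2` matrix
of power series (`mat`); its first column is determined by `x'_ii, x_{i-1,i}` and its second column
by `x_{i+1,i}, x_ii`. A point `p` and a line `l` are incident exactly if their matrices satisfy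
`lnMat l * Lo (-p_1) ≡ ptMat p * Up l_1` for two root subgroups `Up`, `Lo` of `GL₂(F⟦X⟧)`, modulo
the matrices that vanish in the first `k` positions (`incident_iff`). Hence `D(k, q)` is the
geometry of cosets of the two root subgroups in a quotient of a group of matrices.

* Left multiplication by the group acts on the graph, and transitively on incident pairs
  (`exists_iso_zero`). This gives all of the transitivity statements, and it makes the components
  isomorphic, so that `v N = 2 q ^ κ`.
* `Up` and `Lo` have determinant `1`, so the coefficients of the determinant of a vertex matrix are
  constant on components; there are enough of them to give `N ≥ q ^ (t - 1)` (`le_numComponents`).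
* For the lower bound on the girth, an edge of a short cycle may be moved to the zero point and the
  zero line. The coordinates `x_1, x_11, x_12, x_22, x_23, …` along the cycle obey a simple
  recursion; followed in the two directions around the cycle, it gives the antipodal vertex a
  coordinate that is both zero and nonzero (`ne_of_walks_from_flag`). A cycle exists since the
  component is regular of degree at least `2`.
* If `F` has an element `ω` of order `m = (k + 5) / 2`, the product of the matrices
  `Up (ω ^ i) * Lo (ω ^ i)` for `i < m` is trivial in low degrees: it is conjugate to its image
  under an automorphism that multiplies the part of weight `e` by `ω ^ e` (`word_cong_one`). Its partial
  products describe a cycle of length `2 m = k + 5`.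
-/

namespace LazebnikUstimenko

open PowerSeries Matrix

variable {F : Type*} [Field F]

/-! ### Power series matrices and the matrix form of incidence -/

/-- The coefficients of `f` in all degrees `j` with `4 * j < s` vanish. Degrees are scaled by `4`
because consecutive coefficients of an entry of a vertex matrix lie four positions apart. -/
def VanishBelow (s : ℕ) (f : F⟦X⟧) : Prop := ∀ j, 4 * j < s → coeff j f = 0

namespace VanishBelow

theorem mono {s r : ℕ} {f : F⟦X⟧} (h : VanishBelow s f) (hr : r ≤ s) : VanishBelow r f :=
  fun j hj => h j (by omega)

theorem zero (s : ℕ) : VanishBelow s (0 : F⟦X⟧) := fun j _ => by simp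

theorem add {s : ℕ} {f g : F⟦X⟧} (hf : VanishBelow s f) (hg : VanishBelow s g) :
    VanishBelow s (f + g) := fun j hj => by simp [hf j hj, hg j hj]

theorem neg {s : ℕ} {f : F⟦X⟧} (hf : VanishBelow s f) : VanishBelow s (-f) :=
  fun j hj => by simp [hf j hj]

theorem mul_left {s : ℕ} {f : F⟦X⟧} (hf : VanishBelow s f) (g : F⟦X⟧) :
    VanishBelow s (g * f) := by
  intro j hj
  rw [coeff_mul]
  refine Finset.sum_eq_zero fun x hx => ?_
  have := Finset.HasAntidiagonal.mem_antidiagonal.1 hx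
  rw [hf x.2 (by omega), mul_zero]

theorem mul_right {s : ℕ} {f : F⟦X⟧} (hf : VanishBelow s f) (g : F⟦X⟧) :
    VanishBelow s (f * g) := mul_comm g f ▸ hf.mul_left g

theorem mul_left_of_coeff_zero {s : ℕ} {f g : F⟦X⟧} (hf : VanishBelow s f)
    (hg : coeff 0 g = 0) : VanishBelow (s + 4) (g * f) := by
  intro j hj
  rw [coeff_mul]
  refine Finset.sum_eq_zero fun x hx => ?_
  have := Finset.HasAntidiagonal.mem_antidiagonal.1 hx
  rcases Nat.eq_zero_or_pos x.1 with h | h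
  · rw [h, hg, zero_mul]
  · rw [hf x.2 (by omega), mul_zero]

theorem mul_right_of_coeff_zero {s : ℕ} {f g : F⟦X⟧} (hf : VanishBelow s f)
    (hg : coeff 0 g = 0) : VanishBelow (s + 4) (f * g) :=
  mul_comm g f ▸ hf.mul_left_of_coeff_zero hg

end VanishBelow

/-- The matrices all of whose entries vanish in the first `n` positions, when the coefficients of
the four entries are placed as in `mat`. This is a two-sided module over the order of matrices that
are upper triangular modulo `X`: see `Filt.mul_left` and `Filt.mul_right`. -/
def Filt (n : ℕ) : AddSubgroup (Matrix (Fin 2) (Fin 2) F⟦X⟧) where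
  carrier := {M | VanishBelow (n + 3) (M 0 0) ∧ VanishBelow (n + 1) (M 0 1) ∧
    VanishBelow (n + 6) (M 1 0) ∧ VanishBelow (n + 4) (M 1 1)}
  zero_mem' := ⟨.zero _, .zero _, .zero _, .zero _⟩
  add_mem' := fun hM hN => ⟨hM.1.add hN.1, hM.2.1.add hN.2.1, hM.2.2.1.add hN.2.2.1,
    hM.2.2.2.add hN.2.2.2⟩
  neg_mem' := fun hM => ⟨hM.1.neg, hM.2.1.neg, hM.2.2.1.neg, hM.2.2.2.neg⟩

theorem Filt.mul_left {n : ℕ} {M : Matrix (Fin 2) (Fin 2) F⟦X⟧} (hM : M ∈ Filt n)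
    {A : Matrix (Fin 2) (Fin 2) F⟦X⟧} (hA : coeff 0 (A 1 0) = 0) : A * M ∈ Filt n := by
  obtain ⟨ha, hb, hc, hd⟩ := hM
  refine ⟨?_, ?_, ?_, ?_⟩ <;> rw [Matrix.mul_apply, Fin.sum_univ_two]
  · exact (ha.mul_left _).add ((hc.mul_left _).mono (by omega))
  · exact (hb.mul_left _).add ((hd.mul_left _).mono (by omega))
  · exact ((ha.mul_left_of_coeff_zero hA).mono (by omega)).add (hc.mul_left _)
  · exact ((hb.mul_left_of_coeff_zero hA).mono (by omega)).add (hd.mul_left _)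

theorem Filt.mul_right {n : ℕ} {M : Matrix (Fin 2) (Fin 2) F⟦X⟧} (hM : M ∈ Filt n)
    {B : Matrix (Fin 2) (Fin 2) F⟦X⟧} (hB : coeff 0 (B 1 0) = 0) : M * B ∈ Filt n := by
  obtain ⟨ha, hb, hc, hd⟩ := hM
  refine ⟨?_, ?_, ?_, ?_⟩ <;> rw [Matrix.mul_apply, Fin.sum_univ_two]
  · exact (ha.mul_right _).add ((hb.mul_right_of_coeff_zero hB).mono (by omega))
  · exact ((ha.mul_right _).mono (by omega)).add (hb.mul_right _)
  · exact (hc.mul_right _).add ((hd.mul_right_of_coeff_zero hB).mono (by omega))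
  · exact ((hc.mul_right _).mono (by omega)).add (hd.mul_right _)

/-- Congruence of matrices modulo `Filt n`: equality as far as `n` coordinates can tell. -/
def Cong (n : ℕ) (M N : Matrix (Fin 2) (Fin 2) F⟦X⟧) : Prop := M - N ∈ Filt n

namespace Cong

variable {n : ℕ} {M N P : Matrix (Fin 2) (Fin 2) F⟦X⟧}

theorem refl (M : Matrix (Fin 2) (Fin 2) F⟦X⟧) : Cong n M M := by
  simp [Cong]

theorem symm (h : Cong n M N) : Cong n N M := by
  simpa [Cong] using (Filt n).neg_mem h

theorem trans (h : Cong n M N) (h' : Cong n N P) : Cong n M P := by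
  simpa [Cong] using (Filt n).add_mem h h'

theorem mul_left (h : Cong n M N) {A : Matrix (Fin 2) (Fin 2) F⟦X⟧}
    (hA : coeff 0 (A 1 0) = 0) : Cong n (A * M) (A * N) := by
  have := Filt.mul_left h hA
  rwa [mul_sub] at this

theorem mul_right (h : Cong n M N) {B : Matrix (Fin 2) (Fin 2) F⟦X⟧}
    (hB : coeff 0 (B 1 0) = 0) : Cong n (M * B) (N * B) := by
  have := Filt.mul_right h hB
  rwa [sub_mul] at this

theorem coeff_zero_one (h : Cong n M N) : coeff 0 (M 0 1) = coeff 0 (N 0 1) := by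
  have := h.2.1 0 (by omega)
  rwa [Matrix.sub_apply, map_sub, sub_eq_zero] at this

theorem coeff_one_zero (h : Cong n M N) : coeff 1 (M 1 0) = coeff 1 (N 1 0) := by
  have := h.2.2.1 1 (by omega)
  rwa [Matrix.sub_apply, map_sub, sub_eq_zero] at this

end Cong

/-- The elements of the root subgroup that changes the line through a fixed point. -/
noncomputable def Up (x : F) : Matrix (Fin 2) (Fin 2) F⟦X⟧ := !![1, C x; 0, 1]

/-- The elements of the root subgroup that changes the point on a fixed line. -/
noncomputable def Lo (y : F) : Matrix (Fin 2) (Fin 2) F⟦X⟧ := !![1, 0; C y * X, 1]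

theorem Up_mul_Up (x y : F) : Up x * Up y = Up (x + y) := by
  simp [Up, add_comm]

theorem Lo_mul_Lo (x y : F) : Lo x * Lo y = Lo (x + y) := by
  simp [Lo, add_mul]

@[simp] theorem Up_zero : Up (0 : F) = 1 := by simp [Up, Matrix.one_fin_two]

@[simp] theorem Lo_zero : Lo (0 : F) = 1 := by simp [Lo, Matrix.one_fin_two]

theorem coeff_Up (x : F) : coeff 0 (Up x 1 0) = 0 := by simp [Up]

theorem coeff_Lo (y : F) : coeff 0 (Lo y 1 0) = 0 := by simp [Lo]

theorem det_Up (x : F) : (Up x).det = 1 := by simp [Up, Matrix.det_fin_two]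

theorem det_Lo (x : F) : (Lo x).det = 1 := by simp [Lo, Matrix.det_fin_two]

/-- The matrices that are upper triangular modulo `X` with diagonal `1, ε` there, and whose
determinant has no linear term. For `ε = 1` they form the group that acts on the graph; for `ε =
-1` they represent flags, that is, incident pairs of a point and a line. The condition on the
determinant reflects that there is only one coordinate `x_11`, while there are two coordinates
`x_ii, x'_ii` for each `i ≥ 2`. -/
structure IsFlag (ε : F) (M : Matrix (Fin 2) (Fin 2) F⟦X⟧) : Prop where
  a0 : coeff 0 (M 0 0) = 1
  c0 : coeff 0 (M 1 0) = 0
  d0 : coeff 0 (M 1 1) = ε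
  det1 : coeff 1 M.det = 0

theorem coeff_one_mul' (f g : F⟦X⟧) :
    coeff 1 (f * g) = coeff 0 f * coeff 1 g + coeff 1 f * coeff 0 g := by
  rw [coeff_mul]
  simp [Finset.Nat.antidiagonal_succ]

theorem coeff_zero_mul' (f g : F⟦X⟧) : coeff 0 (f * g) = coeff 0 f * coeff 0 g := by
  simp

theorem IsFlag.mul {ε δ : F} {A M : Matrix (Fin 2) (Fin 2) F⟦X⟧} (hA : IsFlag ε A)
    (hM : IsFlag δ M) : IsFlag (ε * δ) (A * M) where
  a0 := by
    simp only [Matrix.mul_apply, Fin.sum_univ_two, map_add, coeff_zero_mul', hA.a0, hM.a0, hM.c0]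
    ring
  c0 := by
    simp only [Matrix.mul_apply, Fin.sum_univ_two, map_add, coeff_zero_mul', hA.c0, hM.c0]
    ring
  d0 := by
    simp only [Matrix.mul_apply, Fin.sum_univ_two, map_add, coeff_zero_mul', hA.c0, hA.d0, hM.d0]
    ring
  det1 := by
    rw [Matrix.det_mul, coeff_one_mul', hA.det1, hM.det1]; ring

theorem isFlag_Up (x : F) : IsFlag 1 (Up x) :=
  ⟨by simp [Up], by simp [Up], by simp [Up], by simp [det_Up, coeff_one]⟩

theorem isFlag_Lo (x : F) : IsFlag 1 (Lo x) :=
  ⟨by simp [Lo], by simp [Lo], by simp [Lo], by simp [det_Lo, coeff_one]⟩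

theorem IsFlag.mul_Up {ε : F} {M : Matrix (Fin 2) (Fin 2) F⟦X⟧} (hM : IsFlag ε M) (x : F) :
    IsFlag ε (M * Up x) := by simpa using hM.mul (isFlag_Up x)

theorem IsFlag.mul_Lo {ε : F} {M : Matrix (Fin 2) (Fin 2) F⟦X⟧} (hM : IsFlag ε M) (x : F) :
    IsFlag ε (M * Lo x) := by simpa using hM.mul (isFlag_Lo x)

theorem IsFlag.coeff_mul_Up {ε : F} {M : Matrix (Fin 2) (Fin 2) F⟦X⟧} (hM : IsFlag ε M) (x : F) :
    coeff 0 ((M * Up x) 0 1) = coeff 0 (M 0 1) + x := by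
  have := hM.a0
  simp only [Matrix.mul_apply, Fin.sum_univ_two, Up]
  simp at *
  rw [this]; ring

theorem IsFlag.coeff_mul_Lo {ε : F} {M : Matrix (Fin 2) (Fin 2) F⟦X⟧} (hM : IsFlag ε M) (y : F) :
    coeff 1 ((M * Lo y) 1 0) = coeff 1 (M 1 0) + y * ε := by
  have := hM.d0
  simp only [Matrix.mul_apply, Fin.sum_univ_two, Lo, map_add, coeff_one_mul']
  simp at *
  rw [this]; ring

theorem IsFlag.exists_inv {ε : F} (hε : ε ≠ 0) {M : Matrix (Fin 2) (Fin 2) F⟦X⟧} (hM : IsFlag ε M) :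
    ∃ B, IsFlag ε⁻¹ B ∧ M * B = 1 ∧ B * M = 1 := by
  have hdet0 : coeff 0 M.det = ε := by
    rw [Matrix.det_fin_two, map_sub, coeff_zero_mul', coeff_zero_mul', hM.a0, hM.c0, hM.d0]; ring
  have hu : IsUnit M.det := by
    rw [PowerSeries.isUnit_iff_constantCoeff, ← coeff_zero_eq_constantCoeff_apply, hdet0]
    exact isUnit_iff_ne_zero.2 hε
  have h1 := Matrix.mul_nonsing_inv M hu
  have h2 := Matrix.nonsing_inv_mul M hu
  refine ⟨M⁻¹, ?_, h1, h2⟩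
  set B := M⁻¹
  have e00 := congrArg (coeff 0) (congrFun (congrFun h1 0) 0)
  have e10 := congrArg (coeff 0) (congrFun (congrFun h1 1) 0)
  have e11 := congrArg (coeff 0) (congrFun (congrFun h1 1) 1)
  simp only [Matrix.mul_apply, Fin.sum_univ_two, map_add, coeff_zero_mul', hM.a0, hM.c0,
    hM.d0] at e00 e10 e11
  have c0 : coeff 0 (B 1 0) = 0 := by
    simpa [hε] using e10
  have a0 : coeff 0 (B 0 0) = 1 := by
    rw [c0] at e00; simpa using e00
  have d0 : coeff 0 (B 1 1) = ε⁻¹ := by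
    refine eq_inv_of_mul_eq_one_right ?_
    simpa using e11
  refine ⟨a0, c0, d0, ?_⟩
  have hd := congrArg (coeff 1) (congrArg Matrix.det h1)
  rw [Matrix.det_mul, coeff_one_mul', hM.det1, hdet0] at hd
  simpa [hε, coeff_one] using hd

/-- The matrix with the entries `a = 1 + ∑ x'_ii X ^ i` (where `x'_11 = x_11`),
`b = β + ∑ x_{i+1,i} X ^ i`, `c = γ X + ∑ x_{i-1,i} X ^ i` (sum over `i ≥ 2`) and
`d = -1 + ∑ x_ii X ^ i`. -/
noncomputable def mat (β γ : F) (x : ℕ → F) : Matrix (Fin 2) (Fin 2) F⟦X⟧ :=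
  !![mk fun | 0 => 1 | j + 1 => x (4 * j + 1), mk fun | 0 => β | j + 1 => x (4 * j + 3);
     mk fun | 0 => 0 | 1 => γ | j + 2 => x (4 * j + 2),
     mk fun | 0 => -1 | 1 => x 1 | j + 2 => x (4 * j + 4)]

/-- The matrix of the point `p`; here `b` has no constant term and `p_1` is the linear term of `c`.
-/
noncomputable def ptMat {n : ℕ} (p : Fin n → F) : Matrix (Fin 2) (Fin 2) F⟦X⟧ :=
  mat 0 (extend p 0) (extend p)

/-- The matrix of the line `l`; here `l_1` is the constant term of `b` and `c` has no linear term.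
-/
noncomputable def lnMat {n : ℕ} (l : Fin n → F) : Matrix (Fin 2) (Fin 2) F⟦X⟧ :=
  mat (extend l 0) 0 (extend l)

theorem isFlag_mat {β γ : F} (h : β * γ = 0) (x : ℕ → F) : IsFlag (-1) (mat β γ x) where
  a0 := by simp [mat]
  c0 := by simp [mat]
  d0 := by simp [mat]
  det1 := by
    simp only [mat, Matrix.det_fin_two, map_sub, coeff_one_mul']
    simp [h]

theorem isFlag_ptMat {n : ℕ} (p : Fin n → F) : IsFlag (-1) (ptMat p) := isFlag_mat (zero_mul _) _

theorem isFlag_lnMat {n : ℕ} (p : Fin n → F) : IsFlag (-1) (lnMat p) := isFlag_mat (mul_zero _) _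

theorem coeff_ptMat_zero_one {n : ℕ} (p : Fin n → F) : coeff 0 (ptMat p 0 1) = 0 := by
  simp [ptMat, mat]

theorem coeff_lnMat_one_zero {n : ℕ} (l : Fin n → F) : coeff 1 (lnMat l 1 0) = 0 := by
  simp [lnMat, mat]

theorem coeff_ptMat_one_zero {n : ℕ} (p : Fin n → F) : coeff 1 (ptMat p 1 0) = extend p 0 := by
  simp [ptMat, mat]

theorem coeff_lnMat_zero_one {n : ℕ} (l : Fin n → F) : coeff 0 (lnMat l 0 1) = extend l 0 := by
  simp [lnMat, mat]

/-- The vector of coordinates that is stored in a matrix. In position `0` a sum is taken so that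
the same function serves for points (`b` has constant term `0`) and for lines (`c` has linear term
`0`). -/
noncomputable def coords (M : Matrix (Fin 2) (Fin 2) F⟦X⟧) : ℕ → F
  | 0 => coeff 0 (M 0 1) + coeff 1 (M 1 0)
  | 1 => coeff 1 (M 0 0)
  | m + 2 =>
    match m % 4 with
    | 0 => coeff (m / 4 + 2) (M 1 0)
    | 1 => coeff (m / 4 + 1) (M 0 1)
    | 2 => coeff (m / 4 + 2) (M 1 1)
    | _ => coeff (m / 4 + 2) (M 0 0)

theorem coords_a (M : Matrix (Fin 2) (Fin 2) F⟦X⟧) (j : ℕ) :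
    coords M (4 * j + 1) = coeff (j + 1) (M 0 0) := by
  rcases j with _ | j
  · rfl
  · have h1 : (4 * j + 3) % 4 = 3 := by omega
    have h2 : (4 * j + 3) / 4 = j := by omega
    change coords M ((4 * j + 3) + 2) = _
    simp only [coords, h1, h2]

theorem coords_b (M : Matrix (Fin 2) (Fin 2) F⟦X⟧) (j : ℕ) :
    coords M (4 * j + 3) = coeff (j + 1) (M 0 1) := by
  have h1 : (4 * j + 1) % 4 = 1 := by omega
  have h2 : (4 * j + 1) / 4 = j := by omega
  change coords M ((4 * j + 1) + 2) = _
  simp only [coords, h1, h2]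

theorem coords_c (M : Matrix (Fin 2) (Fin 2) F⟦X⟧) (j : ℕ) :
    coords M (4 * j + 2) = coeff (j + 2) (M 1 0) := by
  have h1 : (4 * j) % 4 = 0 := by omega
  have h2 : (4 * j) / 4 = j := by omega
  change coords M ((4 * j) + 2) = _
  simp only [coords, h1, h2]

theorem coords_d (M : Matrix (Fin 2) (Fin 2) F⟦X⟧) (j : ℕ) :
    coords M (4 * j + 4) = coeff (j + 2) (M 1 1) := by
  have h1 : (4 * j + 2) % 4 = 2 := by omega
  have h2 : (4 * j + 2) / 4 = j := by omega
  change coords M ((4 * j + 2) + 2) = _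
  simp only [coords, h1, h2]

/-- The positions `≥ 1` of a vector belong cyclically to the entries `a, c, b, d`. -/
theorem position_cases {P : ℕ → Prop} (h0 : P 0) (ha : ∀ j, P (4 * j + 1))
    (hc : ∀ j, P (4 * j + 2)) (hb : ∀ j, P (4 * j + 3)) (hd : ∀ j, P (4 * j + 4)) (m : ℕ) :
    P m := by
  rcases Nat.eq_zero_or_pos m with rfl | hm
  · exact h0
  have h : m - 1 = 4 * ((m - 1) / 4) + (m - 1) % 4 := by omega
  have h4 : (m - 1) % 4 < 4 := Nat.mod_lt _ (by norm_num)
  generalize (m - 1) / 4 = j at h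
  obtain h' | h' | h' | h' : m = 4 * j + 1 ∨ m = 4 * j + 2 ∨ m = 4 * j + 3 ∨ m = 4 * j + 4 := by
    omega
  all_goals subst h'
  exacts [ha j, hc j, hb j, hd j]

theorem coords_mat {β γ : F} {x : ℕ → F} (h : β + γ = x 0) : coords (mat β γ x) = x := by
  funext m
  refine position_cases (P := fun m => coords (mat β γ x) m = x m) ?_ ?_ ?_ ?_ ?_ m
  · simp [coords, mat, h]
  · intro j; rw [coords_a]; simp [mat]
  · intro j; rw [coords_c]; simp [mat]
  · intro j; rw [coords_b]; simp [mat]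
  · intro j; rw [coords_d]; simp [mat]

theorem Cong.coords_eq {n : ℕ} {M N : Matrix (Fin 2) (Fin 2) F⟦X⟧} (h : Cong n M N) {m : ℕ}
    (hm : m < n) : coords M m = coords N m := by
  obtain ⟨ha, hb, hc, hd⟩ := h
  simp only [VanishBelow, Matrix.sub_apply, map_sub, sub_eq_zero] at ha hb hc hd
  revert hm
  refine position_cases (P := fun m => m < n → coords M m = coords N m) ?_ ?_ ?_ ?_ ?_ m
  · intro _
    simp only [coords]; rw [hb 0 (by omega), hc 1 (by omega)]
  · intro j hj; rw [coords_a, coords_a, ha _ (by omega)]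
  · intro j hj; rw [coords_c, coords_c, hc _ (by omega)]
  · intro j hj; rw [coords_b, coords_b, hb _ (by omega)]
  · intro j hj; rw [coords_d, coords_d, hd _ (by omega)]

theorem extend_of_lt {n m : ℕ} (x : Fin n → F) (h : m < n) : extend x m = x ⟨m, h⟩ := dif_pos h

theorem ptMat_injective {n : ℕ} {p p' : Fin n → F} (h : Cong n (ptMat p) (ptMat p')) : p = p' := by
  funext i
  have := h.coords_eq i.2
  rw [ptMat, ptMat, coords_mat (zero_add _), coords_mat (zero_add _), extend_of_lt _ i.2,
    extend_of_lt _ i.2] at this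
  exact this

theorem lnMat_injective {n : ℕ} {p p' : Fin n → F} (h : Cong n (lnMat p) (lnMat p')) : p = p' := by
  funext i
  have := h.coords_eq i.2
  rw [lnMat, lnMat, coords_mat (add_zero _), coords_mat (add_zero _), extend_of_lt _ i.2,
    extend_of_lt _ i.2] at this
  exact this

/-- Up to `Filt n`, a flag matrix in which one of `β`, `γ` vanishes is the matrix of a vector. The
linear terms of `a` and `d` agree because the determinant has no linear term. -/
theorem cong_mat {n : ℕ} (hn : 2 ≤ n) {β γ : F} {x : ℕ → F} {M : Matrix (Fin 2) (Fin 2) F⟦X⟧}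
    (hM : IsFlag (-1) M) (hβ : coeff 0 (M 0 1) = β) (hγ : coeff 1 (M 1 0) = γ) (h : β * γ = 0)
    (hx : ∀ m < n, x m = coords M m) : Cong n (mat β γ x) M := by
  have had : coeff 1 (M 1 1) = coeff 1 (M 0 0) := by
    have := hM.det1
    rw [Matrix.det_fin_two, map_sub, coeff_one_mul', coeff_one_mul', hM.a0, hM.c0, hM.d0, hβ, hγ,
      h] at this
    linear_combination this
  refine ⟨?_, ?_, ?_, ?_⟩ <;> intro j hj <;> rw [Matrix.sub_apply, map_sub, sub_eq_zero]
  · rcases j with _ | j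
    · rw [hM.a0]; simp [mat]
    · rw [← coords_a M, ← hx _ (by omega)]; simp [mat]
  · rcases j with _ | j
    · rw [hβ]; simp [mat]
    · rw [← coords_b M, ← hx _ (by omega)]; simp [mat]
  · rcases j with _ | _ | j
    · rw [hM.c0]; simp [mat]
    · simp only [zero_add]; rw [hγ]; simp [mat]
    · rw [← coords_c M, ← hx _ (by omega)]; simp [mat]
  · rcases j with _ | _ | j
    · rw [hM.d0]; simp [mat]
    · simp only [zero_add]
      rw [had, show coeff 1 (M 0 0) = coords M 1 from rfl, ← hx _ (by omega)]; simp [mat]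
    · rw [← coords_d M, ← hx _ (by omega)]; simp [mat]

/-- The point of the flag represented by `M`: the factor `Up _` removes the constant term of `b`. -/
theorem exists_ptMat {n : ℕ} (hn : 2 ≤ n) {M : Matrix (Fin 2) (Fin 2) F⟦X⟧} (hM : IsFlag (-1) M) :
    ∃ p : Fin n → F, Cong n (ptMat p) (M * Up (-coeff 0 (M 0 1))) := by
  set M' := M * Up (-coeff 0 (M 0 1)) with hM'
  have hF : IsFlag (-1) M' := hM.mul_Up _
  have hb : coeff 0 (M' 0 1) = 0 := by rw [hM', hM.coeff_mul_Up]; ring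
  refine ⟨fun i => coords M' i, cong_mat hn hF hb ?_ (by simp) fun m hm => extend_of_lt _ hm⟩
  rw [extend_of_lt _ (by omega : 0 < n)]
  simp only [coords]
  rw [hb, zero_add]

/-- The line of the flag represented by `M`: the factor `Lo _` removes the linear term of `c`. -/
theorem exists_lnMat {n : ℕ} (hn : 2 ≤ n) {M : Matrix (Fin 2) (Fin 2) F⟦X⟧} (hM : IsFlag (-1) M) :
    ∃ l : Fin n → F, Cong n (lnMat l) (M * Lo (coeff 1 (M 1 0))) := by
  set M' := M * Lo (coeff 1 (M 1 0)) with hM'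
  have hF : IsFlag (-1) M' := hM.mul_Lo _
  have hc : coeff 1 (M' 1 0) = 0 := by rw [hM', hM.coeff_mul_Lo]; ring
  refine ⟨fun i => coords M' i, cong_mat hn hF ?_ hc (by simp) fun m hm => extend_of_lt _ hm⟩
  rw [extend_of_lt _ (by omega : 0 < n)]
  simp only [coords]
  rw [hc, add_zero]

theorem rhs_a (l p : ℕ → F) (j : ℕ) : rhs l p (4 * j + 5) = l (4 * j + 3) * p 0 := by
  have h1 : (4 * j + 1) % 4 = 1 := by omega
  change rhs l p ((4 * j + 1) + 4) = _
  simp only [rhs, h1]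

theorem rhs_b (l p : ℕ → F) (j : ℕ) : rhs l p (4 * j + 3) = l 0 * p (4 * j + 1) := by
  rcases j with _ | j
  · rfl
  have h1 : (4 * j + 3) % 4 = 3 := by omega
  change rhs l p ((4 * j + 3) + 4) = _
  simp only [rhs, h1]
  rfl

theorem rhs_c (l p : ℕ → F) (j : ℕ) : rhs l p (4 * j + 6) = l (4 * j + 4) * p 0 := by
  have h1 : (4 * j + 2) % 4 = 2 := by omega
  change rhs l p ((4 * j + 2) + 4) = _
  simp only [rhs, h1]

theorem rhs_d (l p : ℕ → F) (j : ℕ) : rhs l p (4 * j + 4) = l 0 * p (4 * j + 2) := by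
  have h1 : (4 * j) % 4 = 0 := by omega
  change rhs l p ((4 * j) + 4) = _
  simp only [rhs, h1]

/-- Incidence in matrix form. Comparing columns, the congruence says that the second columns differ
by `l_1` times the first column of the point, and the first columns by `p_1 X` times the second
column of the line; coefficientwise these are the incidence relations. -/
theorem incident_iff {n : ℕ} (hn : 2 ≤ n) (p l : Fin n → F) :
    Incident p l ↔ Cong n (lnMat l * Lo (-extend p 0)) (ptMat p * Up (extend l 0)) := by
  have hb : ∀ j, coeff j ((lnMat l * Lo (-extend p 0) - ptMat p * Up (extend l 0)) 0 1) =
      coeff j (lnMat l 0 1) - coeff j (ptMat p 0 1) - extend l 0 * coeff j (ptMat p 0 0) := by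
    intro j
    simp only [Matrix.sub_apply, Matrix.mul_apply, Fin.sum_univ_two, Lo, Up]
    simp [mul_comm]
    ring
  have hd : ∀ j, coeff j ((lnMat l * Lo (-extend p 0) - ptMat p * Up (extend l 0)) 1 1) =
      coeff j (lnMat l 1 1) - coeff j (ptMat p 1 1) - extend l 0 * coeff j (ptMat p 1 0) := by
    intro j
    simp only [Matrix.sub_apply, Matrix.mul_apply, Fin.sum_univ_two, Lo, Up]
    simp [mul_comm]
    ring
  have ha : ∀ j, coeff (j + 1) ((lnMat l * Lo (-extend p 0) - ptMat p * Up (extend l 0)) 0 0) =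
      coeff (j + 1) (lnMat l 0 0) - coeff (j + 1) (ptMat p 0 0) -
        extend p 0 * coeff j (lnMat l 0 1) := by
    intro j
    simp only [Matrix.sub_apply, Matrix.mul_apply, Fin.sum_univ_two, Lo, Up]
    simp [← mul_assoc, coeff_succ_mul_X, mul_comm]
    ring
  have hc : ∀ j, coeff (j + 1) ((lnMat l * Lo (-extend p 0) - ptMat p * Up (extend l 0)) 1 0) =
      coeff (j + 1) (lnMat l 1 0) - coeff (j + 1) (ptMat p 1 0) -
        extend p 0 * coeff j (lnMat l 1 1) := by
    intro j
    simp only [Matrix.sub_apply, Matrix.mul_apply, Fin.sum_univ_two, Lo, Up]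
    simp [← mul_assoc, coeff_succ_mul_X, mul_comm]
    ring
  have h00 : coeff 0 ((lnMat l * Lo (-extend p 0) - ptMat p * Up (extend l 0)) 0 0) = 0 := by
    rw [Matrix.sub_apply, map_sub, ((isFlag_lnMat l).mul_Lo _).a0, ((isFlag_ptMat p).mul_Up _).a0,
      sub_self]
  have h10 : coeff 0 ((lnMat l * Lo (-extend p 0) - ptMat p * Up (extend l 0)) 1 0) = 0 := by
    rw [Matrix.sub_apply, map_sub, ((isFlag_lnMat l).mul_Lo _).c0, ((isFlag_ptMat p).mul_Up _).c0,
      sub_self]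
  constructor
  · intro h
    refine ⟨?_, ?_, ?_, ?_⟩ <;> intro j hj
    · rcases j with _ | _ | j
      · exact h00
      · rw [ha]
        have := h 1 le_rfl (by omega)
        simp [lnMat, ptMat, mat, rhs] at this ⊢
        linear_combination this
      · rw [ha]
        have := h (4 * j + 5) (by omega) (by omega)
        rw [rhs_a] at this
        simp [lnMat, ptMat, mat, show 4 * (j + 1) + 1 = 4 * j + 5 by ring]
        linear_combination this
    · rw [hb]
      rcases j with _ | j
      · simp [lnMat, ptMat, mat]
      · have := h (4 * j + 3) (by omega) (by omega)
        rw [rhs_b] at this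
        simp [lnMat, ptMat, mat]
        linear_combination this
    · rcases j with _ | _ | _ | j
      · exact h10
      · rw [hc]
        simp [lnMat, ptMat, mat]
      · rw [hc]
        have := h 2 (by omega) (by omega)
        simp [lnMat, ptMat, mat, rhs] at this ⊢
        linear_combination this
      · rw [hc]
        have := h (4 * j + 6) (by omega) (by omega)
        rw [rhs_c] at this
        simp [lnMat, ptMat, mat, show 4 * (j + 1) + 2 = 4 * j + 6 by ring]
        linear_combination this
    · rw [hd]
      rcases j with _ | _ | j
      · simp [lnMat, ptMat, mat]
      · have := h 1 le_rfl (by omega)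
        simp [lnMat, ptMat, mat, rhs] at this ⊢
        linear_combination this
      · have := h (4 * j + 4) (by omega) (by omega)
        rw [rhs_d] at this
        simp [lnMat, ptMat, mat]
        linear_combination this
  · rintro ⟨h1, h2, h3, h4⟩ m hm
    revert hm
    refine position_cases (P := fun m => 1 ≤ m → m < n →
      extend l m - extend p m = rhs (extend l) (extend p) m) ?_ ?_ ?_ ?_ ?_ m
    · intro h; omega
    · rintro (_ | j) _ hj
      · have := h1 1 (by omega)
        rw [ha 0] at this
        simp [lnMat, ptMat, mat, rhs] at this ⊢
        linear_combination this
      · have := h1 (j + 1 + 1) (by omega)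
        rw [ha] at this
        rw [show 4 * (j + 1) + 1 = 4 * j + 5 by ring, rhs_a]
        simp [lnMat, ptMat, mat, show 4 * (j + 1) + 1 = 4 * j + 5 by ring] at this
        linear_combination this
    · rintro (_ | j) _ hj
      · have := h3 2 (by omega)
        rw [hc 1] at this
        simp [lnMat, ptMat, mat, rhs] at this ⊢
        linear_combination this
      · have := h3 (j + 2 + 1) (by omega)
        rw [hc] at this
        rw [show 4 * (j + 1) + 2 = 4 * j + 6 by ring, rhs_c]
        simp [lnMat, ptMat, mat, show 4 * (j + 1) + 2 = 4 * j + 6 by ring] at this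
        linear_combination this
    · intro j _ hj
      have := h2 (j + 1) (by omega)
      rw [hb] at this
      rw [rhs_b]
      simp [lnMat, ptMat, mat] at this
      linear_combination this
    · intro j _ hj
      have := h4 (j + 2) (by omega)
      rw [hd] at this
      rw [rhs_d]
      simp [lnMat, ptMat, mat] at this
      linear_combination this

/-! ### Automorphisms from left multiplication -/

/-- The matrix `A` maps the point `p` to `p'`. A point is a coset of the subgroup of all `Up β`, so
`A * ptMat p` has to be normalized by such a factor. -/
def PtRel {n : ℕ} (A : Matrix (Fin 2) (Fin 2) F⟦X⟧) (p p' : Fin n → F) : Prop :=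
  ∃ β, Cong n (ptMat p') (A * ptMat p * Up β)

/-- The matrix `A` maps the line `l` to `l'`. A line is a coset of the subgroup of all `Lo γ`. -/
def LnRel {n : ℕ} (A : Matrix (Fin 2) (Fin 2) F⟦X⟧) (l l' : Fin n → F) : Prop :=
  ∃ γ, Cong n (lnMat l') (A * lnMat l * Lo γ)

theorem IsFlag.exists_ptRel {n : ℕ} (hn : 2 ≤ n) {A : Matrix (Fin 2) (Fin 2) F⟦X⟧}
    (hA : IsFlag 1 A) (p : Fin n → F) : ∃ p', PtRel A p p' := by
  obtain ⟨p', h⟩ := exists_ptMat hn (M := A * ptMat p) (by simpa using hA.mul (isFlag_ptMat p))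
  exact ⟨p', _, h⟩

theorem IsFlag.exists_lnRel {n : ℕ} (hn : 2 ≤ n) {A : Matrix (Fin 2) (Fin 2) F⟦X⟧}
    (hA : IsFlag 1 A) (l : Fin n → F) : ∃ l', LnRel A l l' := by
  obtain ⟨p', h⟩ := exists_lnMat hn (M := A * lnMat l) (by simpa using hA.mul (isFlag_lnMat l))
  exact ⟨p', _, h⟩

theorem PtRel.comp {n : ℕ} {A B : Matrix (Fin 2) (Fin 2) F⟦X⟧} (hB : IsFlag 1 B)
    {p p' p'' : Fin n → F} (h : PtRel A p p') (h' : PtRel B p' p'') : PtRel (B * A) p p'' := by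
  obtain ⟨β, h⟩ := h
  obtain ⟨β', h'⟩ := h'
  refine ⟨β + β', h'.trans ?_⟩
  have := (h.mul_left hB.c0).mul_right (coeff_Up β')
  simpa only [mul_assoc, Up_mul_Up] using this

theorem LnRel.comp {n : ℕ} {A B : Matrix (Fin 2) (Fin 2) F⟦X⟧} (hB : IsFlag 1 B)
    {p p' p'' : Fin n → F} (h : LnRel A p p') (h' : LnRel B p' p'') : LnRel (B * A) p p'' := by
  obtain ⟨β, h⟩ := h
  obtain ⟨β', h'⟩ := h'
  refine ⟨β + β', h'.trans ?_⟩
  have := (h.mul_left hB.c0).mul_right (coeff_Lo β')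
  simpa only [mul_assoc, Lo_mul_Lo] using this

theorem PtRel.eq_of_one {n : ℕ} {p p' : Fin n → F} (h : PtRel 1 p p') : p = p' := by
  obtain ⟨β, h⟩ := h
  rw [one_mul] at h
  have := h.coeff_zero_one
  rw [(isFlag_ptMat p).coeff_mul_Up, coeff_ptMat_zero_one, coeff_ptMat_zero_one, zero_add] at this
  rw [← this, Up_zero, mul_one] at h
  exact (ptMat_injective h).symm

theorem LnRel.eq_of_one {n : ℕ} {p p' : Fin n → F} (h : LnRel 1 p p') : p = p' := by
  obtain ⟨β, h⟩ := h
  rw [one_mul] at h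
  have := h.coeff_one_zero
  rw [(isFlag_lnMat p).coeff_mul_Lo, coeff_lnMat_one_zero, coeff_lnMat_one_zero] at this
  have hβ : β = 0 := by linear_combination this
  rw [hβ, Lo_zero, mul_one] at h
  exact (lnMat_injective h).symm

theorem PtRel.unique {n : ℕ} {A : Matrix (Fin 2) (Fin 2) F⟦X⟧} {p p' p'' : Fin n → F}
    (h : PtRel A p p') (h' : PtRel A p p'') : p' = p'' := by
  obtain ⟨β, h⟩ := h
  obtain ⟨β', h'⟩ := h'
  refine PtRel.eq_of_one ⟨β' - β, ?_⟩
  have := h.mul_right (coeff_Up (β' - β))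
  rw [mul_assoc _ (Up β), Up_mul_Up, add_sub_cancel] at this
  rw [one_mul]
  exact h'.trans this.symm

theorem LnRel.unique {n : ℕ} {A : Matrix (Fin 2) (Fin 2) F⟦X⟧} {p p' p'' : Fin n → F}
    (h : LnRel A p p') (h' : LnRel A p p'') : p' = p'' := by
  obtain ⟨β, h⟩ := h
  obtain ⟨β', h'⟩ := h'
  refine LnRel.eq_of_one ⟨β' - β, ?_⟩
  have := h.mul_right (coeff_Lo (β' - β))
  rw [mul_assoc _ (Lo β), Lo_mul_Lo, add_sub_cancel] at this
  rw [one_mul]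
  exact h'.trans this.symm

/-- The parameters `x`, `y` need not be known in advance: reading off the constant term of the
entry `b` and the linear term of `c` shows that they are `l_1` and `-p_1`. -/
theorem incident_of_cong {n : ℕ} (hn : 2 ≤ n) {p l : Fin n → F} {x y : F}
    (h : Cong n (lnMat l * Lo y) (ptMat p * Up x)) : Incident p l := by
  have h1 := h.coeff_zero_one
  have h2 := h.coeff_one_zero
  rw [(isFlag_ptMat p).coeff_mul_Up, coeff_ptMat_zero_one, zero_add] at h1
  rw [(isFlag_lnMat l).coeff_mul_Lo, coeff_lnMat_one_zero] at h2
  have h3 : coeff 0 ((lnMat l * Lo y) 0 1) = extend l 0 := by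
    simp [Matrix.mul_apply, Fin.sum_univ_two, Lo, lnMat, mat]
  have h4 : coeff 1 ((ptMat p * Up x) 1 0) = extend p 0 := by
    simp [Matrix.mul_apply, Fin.sum_univ_two, Up, ptMat, mat]
  rw [h3] at h1
  rw [h4] at h2
  have h5 : y = -extend p 0 := by linear_combination -h2
  rw [incident_iff hn, ← h5, h1]
  exact h

theorem Incident.map {n : ℕ} (hn : 2 ≤ n) {A : Matrix (Fin 2) (Fin 2) F⟦X⟧} (hA : IsFlag 1 A)
    {p l p' l' : Fin n → F} (h : Incident p l) (hp : PtRel A p p') (hl : LnRel A l l') :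
    Incident p' l' := by
  obtain ⟨β, hp⟩ := hp
  obtain ⟨γ, hl⟩ := hl
  rw [incident_iff hn] at h
  have h1 := hl.mul_right (coeff_Lo (-γ - extend p 0))
  have h2 := hp.mul_right (coeff_Up (-β + extend l 0))
  have h3 := h.mul_left hA.c0
  rw [mul_assoc _ (Lo γ), Lo_mul_Lo, show γ + (-γ - extend p 0) = -extend p 0 by ring] at h1
  rw [mul_assoc _ (Up β), Up_mul_Up, show β + (-β + extend l 0) = extend l 0 by ring] at h2
  rw [← mul_assoc, ← mul_assoc] at h3
  exact incident_of_cong hn ((h1.trans h3).trans h2.symm)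

theorem two_le_numCoords (k : ℕ) : 2 ≤ numCoords k := le_max_right _ _

/-- Left multiplication by an invertible matrix induces an automorphism of `D k F`. -/
theorem exists_iso (k : ℕ) {A B : Matrix (Fin 2) (Fin 2) F⟦X⟧} (hA : IsFlag 1 A)
    (hB : IsFlag 1 B) (hAB : A * B = 1) (hBA : B * A = 1) :
    ∃ φ : D k F ≃g D k F, (∀ p p', PtRel A p p' → φ (Sum.inl p) = Sum.inl p') ∧
      ∀ l l', LnRel A l l' → φ (Sum.inr l) = Sum.inr l' := by
  have hn := two_le_numCoords k
  choose f hf using hA.exists_ptRel hn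
  choose f' hf' using hB.exists_ptRel hn
  choose g hg using hA.exists_lnRel hn
  choose g' hg' using hB.exists_lnRel hn
  have e1 : ∀ p, f' (f p) = p := fun p =>
    (PtRel.eq_of_one (hBA ▸ (hf p).comp hB (hf' (f p)))).symm
  have e2 : ∀ p, f (f' p) = p := fun p =>
    (PtRel.eq_of_one (hAB ▸ (hf' p).comp hA (hf (f' p)))).symm
  have e3 : ∀ p, g' (g p) = p := fun p =>
    (LnRel.eq_of_one (hBA ▸ (hg p).comp hB (hg' (g p)))).symm
  have e4 : ∀ p, g (g' p) = p := fun p =>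
    (LnRel.eq_of_one (hAB ▸ (hg' p).comp hA (hg (g' p)))).symm
  have key : ∀ p l, Incident (f p) (g l) ↔ Incident p l := fun p l =>
    ⟨fun h => by simpa only [e1, e3] using h.map hn hB (hf' _) (hg' _),
      fun h => h.map hn hA (hf p) (hg l)⟩
  refine ⟨⟨Equiv.sumCongr ⟨f, f', e1, e2⟩ ⟨g, g', e3, e4⟩, ?_⟩, ?_, ?_⟩
  · rintro (x | x) (y | y)
    · exact Iff.rfl
    · exact key x y
    · exact key y x
    · exact Iff.rfl
  · exact fun p p' h => congrArg Sum.inl ((hf p).unique h)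
  · exact fun p p' h => congrArg Sum.inr ((hg p).unique h)

/-- The matrix of the zero point, of the zero line, and of the flag that they form. -/
noncomputable def baseMat : Matrix (Fin 2) (Fin 2) F⟦X⟧ := !![1, 0; 0, -1]

theorem mat_zero : mat 0 0 (0 : ℕ → F) = baseMat := by
  ext i j m
  fin_cases i <;> fin_cases j <;> rcases m with _ | _ | m <;>
    simp [mat, baseMat, coeff_one]

theorem extend_zero {n : ℕ} : extend (0 : Fin n → F) = 0 := by
  funext m
  simp [extend]

theorem ptMat_zero {n : ℕ} : ptMat (0 : Fin n → F) = baseMat := by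
  rw [ptMat, extend_zero]
  exact mat_zero

theorem lnMat_zero {n : ℕ} : lnMat (0 : Fin n → F) = baseMat := by
  rw [lnMat, extend_zero]
  exact mat_zero

theorem isFlag_baseMat : IsFlag (-1 : F) baseMat := mat_zero (F := F) ▸ isFlag_mat (mul_zero 0) 0

theorem baseMat_mul_self : (baseMat : Matrix (Fin 2) (Fin 2) F⟦X⟧) * baseMat = 1 := by
  simp [baseMat, Matrix.one_fin_two]

/-- The automorphism is left multiplication by `baseMat * g⁻¹`, where `g` represents the given
flag. -/
theorem exists_iso_zero {k : ℕ} {p l : Fin (numCoords k) → F} (h : Incident p l) :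
    ∃ φ : D k F ≃g D k F, φ (Sum.inl p) = Sum.inl 0 ∧ φ (Sum.inr l) = Sum.inr 0 := by
  set g := ptMat p * Up (extend l 0) with hg
  have hgF : IsFlag (-1) g := (isFlag_ptMat p).mul_Up _
  obtain ⟨B, hB, h1, h2⟩ := hgF.exists_inv (by simp)
  have hA : IsFlag 1 (baseMat * B) := by simpa using isFlag_baseMat.mul hB
  obtain ⟨φ, hφ, hφ'⟩ := exists_iso k hA
    (by simpa using hgF.mul isFlag_baseMat : IsFlag 1 (g * baseMat))
    (by rw [mul_assoc, ← mul_assoc B, h2, one_mul, baseMat_mul_self])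
    (by rw [mul_assoc, ← mul_assoc baseMat baseMat, baseMat_mul_self, one_mul, h1])
  refine ⟨φ, hφ _ _ ⟨extend l 0, ?_⟩, hφ' _ _ ⟨-extend p 0, ?_⟩⟩
  · rw [mul_assoc, mul_assoc, ← hg, h2, mul_one, ptMat_zero]
    exact .refl _
  · have := ((incident_iff (two_le_numCoords k) p l).1 h).mul_left hA.c0
    rw [← hg, mul_assoc baseMat B g, h2, mul_one, ← mul_assoc] at this
    rw [lnMat_zero]
    exact this.symm

theorem exists_unique_line {n : ℕ} (hn : 2 ≤ n) (p : Fin n → F) (x : F) :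
    ∃! l, extend l 0 = x ∧ Incident p l := by
  obtain ⟨l, hl⟩ := exists_lnMat hn ((isFlag_ptMat p).mul_Up x)
  have hx : extend l 0 = x := by
    have h1 := hl.coeff_zero_one
    rw [coeff_lnMat_zero_one] at h1
    rw [h1]
    simp [Matrix.mul_apply, Fin.sum_univ_two, Lo, Up, ptMat, mat]
  refine ⟨l, ⟨hx, ?_⟩, ?_⟩
  · have := hl.mul_right (coeff_Lo (-coeff 1 ((ptMat p * Up x) 1 0)))
    rw [mul_assoc _ (Lo _), Lo_mul_Lo, add_neg_cancel, Lo_zero, mul_one] at this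
    exact incident_of_cong hn this
  · rintro l' ⟨hx', h'⟩
    rw [incident_iff hn, hx'] at h'
    have h2 := h'.mul_right (coeff_Lo (extend p 0))
    rw [mul_assoc _ (Lo _), Lo_mul_Lo, neg_add_cancel, Lo_zero, mul_one] at h2
    have h3 : coeff 1 ((ptMat p * Up x) 1 0) = extend p 0 := by
      simp [Matrix.mul_apply, Fin.sum_univ_two, Up, ptMat, mat]
    rw [h3] at hl
    exact lnMat_injective (h2.trans hl.symm)

theorem exists_unique_point {n : ℕ} (hn : 2 ≤ n) (l : Fin n → F) (y : F) :
    ∃! p, extend p 0 = y ∧ Incident p l := by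
  obtain ⟨p, hp⟩ := exists_ptMat hn ((isFlag_lnMat l).mul_Lo (-y))
  have hy : extend p 0 = y := by
    have h1 := hp.coeff_one_zero
    rw [coeff_ptMat_one_zero] at h1
    rw [h1]
    simp [Matrix.mul_apply, Fin.sum_univ_two, Lo, Up, lnMat, mat, coeff_one_mul']
  refine ⟨p, ⟨hy, ?_⟩, ?_⟩
  · have := hp.mul_right (coeff_Up (coeff 0 ((lnMat l * Lo (-y)) 0 1)))
    rw [mul_assoc _ (Up _), Up_mul_Up, neg_add_cancel, Up_zero, mul_one] at this
    exact incident_of_cong hn this.symm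
  · rintro p' ⟨hy', h'⟩
    rw [incident_iff hn, hy'] at h'
    have h2 := h'.mul_right (coeff_Up (-extend l 0))
    rw [mul_assoc _ (Up _), Up_mul_Up, add_neg_cancel, Up_zero, mul_one] at h2
    have h3 : coeff 0 ((lnMat l * Lo (-y)) 0 1) = extend l 0 := by
      simp [Matrix.mul_apply, Fin.sum_univ_two, Lo, lnMat, mat]
    rw [h3] at hp
    exact ptMat_injective (h2.symm.trans hp.symm)

/-! ### Connected components, regularity and transitivity -/

/-- The isomorphism of components induced by an automorphism that maps a vertex of the first
component into the second. -/
def componentIso {V : Type*} {G : SimpleGraph V} (φ : G ≃g G) {C C' : G.ConnectedComponent}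
    {x : V} (hx : x ∈ C) (hx' : φ x ∈ C') : C.toSimpleGraph ≃g C'.toSimpleGraph where
  toEquiv := φ.toEquiv.subtypeEquiv fun a => by
    have hC : C = G.connectedComponentMk x := hx.symm
    have hC' : C' = G.connectedComponentMk (φ x) := hx'.symm
    subst hC hC'
    change G.connectedComponentMk a = _ ↔ G.connectedComponentMk (φ a) = _
    rw [SimpleGraph.ConnectedComponent.eq, SimpleGraph.ConnectedComponent.eq,
      SimpleGraph.Iso.reachable_iff]
  map_rel_iff' := by
    rintro ⟨a, ha⟩ ⟨b, hb⟩
    exact φ.map_adj_iff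

theorem exists_iso_flag {k : ℕ} {p l p' l' : Fin (numCoords k) → F} (h : Incident p l)
    (h' : Incident p' l') :
    ∃ φ : D k F ≃g D k F, φ (Sum.inl p) = Sum.inl p' ∧ φ (Sum.inr l) = Sum.inr l' := by
  obtain ⟨φ, h1, h2⟩ := exists_iso_zero h
  obtain ⟨ψ, h3, h4⟩ := exists_iso_zero h'
  refine ⟨φ.trans ψ.symm, ?_, ?_⟩
  · rw [RelIso.trans_apply, h1, ← h3, RelIso.symm_apply_apply]
  · rw [RelIso.trans_apply, h2, ← h4, RelIso.symm_apply_apply]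

theorem exists_iso_points {k : ℕ} (p p' : Fin (numCoords k) → F) :
    ∃ φ : D k F ≃g D k F, φ (Sum.inl p) = Sum.inl p' := by
  obtain ⟨l, ⟨-, hl⟩, -⟩ := exists_unique_line (two_le_numCoords k) p 0
  obtain ⟨l', ⟨-, hl'⟩, -⟩ := exists_unique_line (two_le_numCoords k) p' 0
  obtain ⟨φ, h, -⟩ := exists_iso_flag hl hl'
  exact ⟨φ, h⟩

theorem exists_iso_lines {k : ℕ} (l l' : Fin (numCoords k) → F) :
    ∃ φ : D k F ≃g D k F, φ (Sum.inr l) = Sum.inr l' := by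
  obtain ⟨p, ⟨-, hp⟩, -⟩ := exists_unique_point (two_le_numCoords k) l 0
  obtain ⟨p', ⟨-, hp'⟩, -⟩ := exists_unique_point (two_le_numCoords k) l' 0
  obtain ⟨φ, -, h⟩ := exists_iso_flag hp hp'
  exact ⟨φ, h⟩

theorem autTransitiveOn_points {k : ℕ} (C : (D k F).ConnectedComponent) :
    AutTransitiveOn (CD C) (points C) := by
  rintro ⟨x, hx⟩ ⟨p, rfl : x = _⟩ ⟨y, hy⟩ ⟨p', rfl : y = _⟩
  obtain ⟨φ, h⟩ := exists_iso_points p p'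
  exact ⟨componentIso φ hx (h ▸ hy), Subtype.ext h⟩

theorem autTransitiveOn_lines {k : ℕ} (C : (D k F).ConnectedComponent) :
    AutTransitiveOn (CD C) (lines C) := by
  rintro ⟨x, hx⟩ ⟨p, rfl : x = _⟩ ⟨y, hy⟩ ⟨p', rfl : y = _⟩
  obtain ⟨φ, h⟩ := exists_iso_lines p p'
  exact ⟨componentIso φ hx (h ▸ hy), Subtype.ext h⟩

theorem exists_incident_of_mem_edgeSet {k : ℕ} {C : (D k F).ConnectedComponent} {e : Sym2 C}
    (he : e ∈ (CD C).edgeSet) : ∃ (p l : Fin (numCoords k) → F) (hp : Sum.inl p ∈ C)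
      (hl : Sum.inr l ∈ C), Incident p l ∧ e = s(⟨_, hp⟩, ⟨_, hl⟩) := by
  induction e using Sym2.ind with | _ x y =>
  obtain ⟨x | x, hx⟩ := x <;> obtain ⟨y | y, hy⟩ := y
  · exact absurd he (fun h => h)
  · exact ⟨x, y, hx, hy, he, rfl⟩
  · exact ⟨y, x, hy, hx, he, Sym2.eq_swap⟩
  · exact absurd he (fun h => h)

theorem autEdgeTransitive_CD {k : ℕ} (C : (D k F).ConnectedComponent) :
    AutEdgeTransitive (CD C) := by
  intro e he f hf
  obtain ⟨p, l, hp, hl, h, rfl⟩ := exists_incident_of_mem_edgeSet he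
  obtain ⟨p', l', hp', hl', h', rfl⟩ := exists_incident_of_mem_edgeSet hf
  obtain ⟨φ, h1, h2⟩ := exists_iso_flag h h'
  refine ⟨componentIso φ hp (h1 ▸ hp'), ?_⟩
  rw [Sym2.map_mk]
  congr 2
  · exact Subtype.ext h1
  · exact Subtype.ext h2

theorem isBipartite_CD {k : ℕ} (C : (D k F).ConnectedComponent) : (CD C).IsBipartite := by
  refine ⟨SimpleGraph.Coloring.mk (fun x => if (x : Vertex k F).isLeft then 0 else 1) ?_⟩
  rintro ⟨x | x, hx⟩ ⟨y | y, hy⟩ h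
  · exact absurd h (fun h => h)
  · simp
  · simp
  · exact absurd h (fun h => h)

theorem card_neighborSet_CD {k : ℕ} (C : (D k F).ConnectedComponent) (x : C) :
    Nat.card ((CD C).neighborSet x) = Nat.card F := by
  have hn := two_le_numCoords k
  refine Nat.card_congr (Equiv.ofBijective
    (fun y => Sum.elim (fun p => extend p 0) (fun l => extend l 0) (y : C).1) ⟨?_, ?_⟩)
  · rintro ⟨⟨y, hy⟩, h⟩ ⟨⟨z, hz⟩, h'⟩ he
    obtain ⟨x | x, hx⟩ := x <;> obtain y | y := y <;> obtain z | z := z <;>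
      first | exact h.elim | exact h'.elim | skip
    · obtain ⟨l, -, hl⟩ := exists_unique_line hn x (extend y 0)
      have : y = z := (hl y ⟨rfl, h⟩).trans (hl z ⟨he.symm, h'⟩).symm
      subst this; rfl
    · obtain ⟨l, -, hl⟩ := exists_unique_point hn x (extend y 0)
      have : y = z := (hl y ⟨rfl, h⟩).trans (hl z ⟨he.symm, h'⟩).symm
      subst this; rfl
  · intro c
    obtain ⟨x | x, hx⟩ := x
    · obtain ⟨l, ⟨h1, h2⟩, -⟩ := exists_unique_line hn x c
      have h3 : (D k F).Adj (Sum.inl x) (Sum.inr l) := h2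
      exact ⟨⟨⟨Sum.inr l, C.mem_supp_of_adj_mem_supp hx h3⟩, h3⟩, h1⟩
    · obtain ⟨l, ⟨h1, h2⟩, -⟩ := exists_unique_point hn x c
      have h3 : (D k F).Adj (Sum.inr x) (Sum.inl l) := h2
      exact ⟨⟨⟨Sum.inl l, C.mem_supp_of_adj_mem_supp hx h3⟩, h3⟩, h1⟩

theorem exists_point_mem {k : ℕ} (C : (D k F).ConnectedComponent) : ∃ p, Sum.inl p ∈ C := by
  obtain ⟨x | x, hx⟩ := C.nonempty_supp
  · exact ⟨x, hx⟩
  · obtain ⟨p, ⟨-, h⟩, -⟩ := exists_unique_point (two_le_numCoords k) x 0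
    have h3 : (D k F).Adj (Sum.inr x) (Sum.inl p) := h
    exact ⟨p, C.mem_supp_of_adj_mem_supp hx h3⟩

/-- All components are isomorphic, by transitivity on the points. -/
theorem nonempty_iso_CD {k : ℕ} (C C' : (D k F).ConnectedComponent) : Nonempty (CD C ≃g CD C') := by
  obtain ⟨p, hp⟩ := exists_point_mem C
  obtain ⟨p', hp'⟩ := exists_point_mem C'
  obtain ⟨φ, h⟩ := exists_iso_points p p'
  exact ⟨componentIso φ hp (h ▸ hp')⟩

theorem order_mul_numComponents {k : ℕ} [Finite F] (C : (D k F).ConnectedComponent) :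
    order (CD C) * numComponents k F = 2 * Nat.card F ^ numCoords k := by
  have h1 : Nat.card (Vertex k F) = 2 * Nat.card F ^ numCoords k := by
    rw [Nat.card_sum, Nat.card_fun, Nat.card_fin]; ring
  rw [← h1, ← Nat.card_congr (Equiv.sigmaFiberEquiv (D k F).connectedComponentMk), order,
    numComponents, mul_comm]
  have h2 : ∀ C' : (D k F).ConnectedComponent,
      Nat.card {x // (D k F).connectedComponentMk x = C'} = Nat.card C := fun C' =>
    Nat.card_congr (nonempty_iso_CD C' C).some.toEquiv
  have := Fintype.ofFinite (D k F).ConnectedComponent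
  rw [Nat.card_sigma, Finset.sum_congr rfl fun C' _ => h2 C']
  simp

/-- The determinant is determined by the first `n` positions only in degrees `r` with
`4 * r < n + 3`. -/
theorem Cong.coeff_det_eq {n : ℕ} {M N : Matrix (Fin 2) (Fin 2) F⟦X⟧} (h : Cong n M N)
    (hM : coeff 0 (M 1 0) = 0) {r : ℕ} (hr : 4 * r < n + 3) : coeff r M.det = coeff r N.det := by
  obtain ⟨ha, hb, hc, hd⟩ := h
  rw [← sub_eq_zero, ← map_sub]
  have e : M.det - N.det = (M - N) 0 0 * M 1 1 + N 0 0 * (M - N) 1 1 - ((M - N) 0 1 * M 1 0 +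
      N 0 1 * (M - N) 1 0) := by
    simp only [Matrix.det_fin_two, Matrix.sub_apply]; ring
  have h1 := ((ha.mul_right (M 1 1)).add ((hd.mul_left (N 0 0)).mono (by omega)))
  have h2 := ((hb.mul_right_of_coeff_zero hM).add ((hc.mul_left (N 0 1)).mono (by omega)))
  rw [e, sub_eq_add_neg]
  exact (h1.add (h2.neg.mono (by omega))) r hr

/-- The matrix of a vertex of `D k F`. -/
noncomputable def vertexMat {k : ℕ} : Vertex k F → Matrix (Fin 2) (Fin 2) F⟦X⟧ :=
  Sum.elim ptMat lnMat

theorem Incident.coeff_det_eq {n : ℕ} (hn : 2 ≤ n) {p l : Fin n → F} (h : Incident p l) {r : ℕ}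
    (hr : 4 * r < n + 3) : coeff r (lnMat l).det = coeff r (ptMat p).det := by
  have := ((incident_iff hn p l).1 h).coeff_det_eq ((isFlag_lnMat l).mul_Lo _).c0 hr
  simpa only [Matrix.det_mul, det_Lo, det_Up, mul_one] using this

/-- The low coefficients of the determinant are invariants of the connected component, as `Up` and
`Lo` have determinant `1`. -/
theorem coeff_det_vertexMat_eq {k r : ℕ} (hr : 4 * r < numCoords k + 3) {x y : Vertex k F}
    (h : (D k F).Reachable x y) : coeff r (vertexMat x).det = coeff r (vertexMat y).det := by
  have hn := two_le_numCoords k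
  obtain ⟨w⟩ := h
  induction w with
  | nil => rfl
  | @cons x y z h _ ih =>
    rw [← ih]
    obtain x | x := x <;> obtain y | y := y
    · exact h.elim
    · exact (Incident.coeff_det_eq hn h hr).symm
    · exact Incident.coeff_det_eq hn h hr
    · exact h.elim

/-- The coefficients of the determinant in the degrees `2, …, t`, where `t = (k + 2) / 4`, take
arbitrary values, already on points with matrix `!![1, 0; c, d]`, whose determinant is `d`. -/
theorem le_numComponents [Finite F] (k : ℕ) :
    Nat.card F ^ ((k + 2) / 4 - 1) ≤ numComponents k F := by
  set t := (k + 2) / 4 with ht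
  have hk : k ≤ numCoords k := le_max_left _ _
  let f : (D k F).ConnectedComponent → Fin (t - 1) → F :=
    SimpleGraph.ConnectedComponent.lift (fun x i => coeff (i + 2) (vertexMat x).det)
      fun x y w _ => funext fun i => coeff_det_vertexMat_eq (by omega) ⟨w⟩
  have hf : Function.Surjective f := by
    intro c
    let p : Fin (numCoords k) → F := fun m =>
      if h : m.1 % 4 = 0 ∧ 4 ≤ m.1 ∧ m.1 / 4 - 1 < t - 1 then c ⟨m.1 / 4 - 1, h.2.2⟩ else 0
    have hp : ∀ m, m % 4 ≠ 0 → extend p m = 0 := by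
      intro m hm
      rw [extend]
      split_ifs with h
      · exact dif_neg fun h' => hm h'.1
      · rfl
    refine ⟨(D k F).connectedComponentMk (Sum.inl p), funext fun i => ?_⟩
    change coeff (i + 2) (ptMat p).det = c i
    have h00 : ptMat p 0 0 = 1 := by
      ext j
      rcases j with _ | j
      · simp [ptMat, mat]
      · simpa [ptMat, mat, coeff_one] using hp _ (by omega)
    have h01 : ptMat p 0 1 = 0 := by
      ext j
      rcases j with _ | j
      · simp [ptMat, mat]
      · simpa [ptMat, mat] using hp _ (by omega)
    rw [Matrix.det_fin_two, h00, h01, one_mul, zero_mul, sub_zero]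
    have hi := i.2
    have h1 : 4 * i.1 + 4 < numCoords k := by omega
    have h2 : coeff (i + 2) (ptMat p 1 1) = extend p (4 * i + 4) := by simp [ptMat, mat]
    rw [h2, extend_of_lt _ h1]
    change dite _ _ _ = _
    rw [dif_pos ⟨by change (4 * i.1 + 4) % 4 = 0; omega, by change 4 ≤ 4 * i.1 + 4; omega,
      by change (4 * i.1 + 4) / 4 - 1 < t - 1; omega⟩]
    congr 1
    ext
    change (4 * i.1 + 4) / 4 - 1 = i.1
    omega
  have := Nat.card_le_card_of_surjective f hf
  rwa [Nat.card_fun, Nat.card_fin] at this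

/-! ### A chain of coordinates along walks -/

/-- The coordinates `x_1, x_11, x_12, x_22, x_23, x_33, …` of a vector, numbered from `1` (with
junk value `0` in position `0`). For `j ≥ 3` the `j`-th one is in position `2 * j - 4`. Apart from
`l_1` and `p_1`, the relation for the `j`-th of them involves only the one before it. -/
def chain (x : ℕ → F) : ℕ → F
  | 0 => 0
  | 1 => x 0
  | 2 => x 1
  | j + 3 => x (2 * j + 2)

theorem chain_zero (j : ℕ) : chain (0 : ℕ → F) j = 0 := by
  rcases j with _ | _ | _ | j <;> rfl

theorem Incident.chain_even {n : ℕ} {p l : Fin n → F} (h : Incident p l) {j : ℕ} (hj : Even j)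
    (hj2 : 2 ≤ j) (hjn : 2 * j < n + 4) (hn : 2 ≤ n) :
    chain (extend l) j - chain (extend p) j = extend l 0 * chain (extend p) (j - 1) := by
  obtain ⟨i, rfl⟩ := hj
  rcases i with _ | _ | i
  · omega
  · exact h 1 le_rfl (by omega)
  · have := h (4 * i + 4) (by omega) (by omega)
    rw [rhs_d] at this
    rw [show i + 1 + 1 + (i + 1 + 1) = (2 * i + 1) + 3 by ring,
      show 2 * i + 1 + 3 - 1 = 2 * i + 3 by omega]
    simp only [chain]
    rw [show 2 * (2 * i + 1) + 2 = 4 * i + 4 by ring, show 2 * (2 * i) + 2 = 4 * i + 2 by ring]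
    exact this

theorem Incident.chain_odd {n : ℕ} {p l : Fin n → F} (h : Incident p l) {j : ℕ} (hj : Odd j)
    (hj2 : 2 ≤ j) (hjn : 2 * j < n + 4) :
    chain (extend l) j - chain (extend p) j = chain (extend l) (j - 1) * extend p 0 := by
  obtain ⟨i, rfl⟩ := hj
  rcases i with _ | _ | i
  · omega
  · exact h 2 (by omega) (by omega)
  · have := h (4 * i + 6) (by omega) (by omega)
    rw [rhs_c] at this
    rw [show 2 * (i + 1 + 1) + 1 = (2 * i + 2) + 3 by ring,
      show 2 * i + 2 + 3 - 1 = (2 * i + 1) + 3 by omega]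
    simp only [chain]
    rw [show 2 * (2 * i + 2) + 2 = 4 * i + 6 by ring,
      show 2 * (2 * i + 1) + 2 = 4 * i + 4 by ring]
    exact this

theorem Incident.eq_of_fst_line {n : ℕ} (hn : 2 ≤ n) {p l l' : Fin n → F} (h : Incident p l)
    (h' : Incident p l') (he : extend l 0 = extend l' 0) : l = l' :=
  (exists_unique_line hn p (extend l' 0)).unique ⟨he, h⟩ ⟨rfl, h'⟩

theorem Incident.eq_of_fst_point {n : ℕ} (hn : 2 ≤ n) {p p' l : Fin n → F} (h : Incident p l)
    (h' : Incident p' l) (he : extend p 0 = extend p' 0) : p = p' :=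
  (exists_unique_point hn l (extend p' 0)).unique ⟨he, h⟩ ⟨rfl, h'⟩

theorem adj_inl {k : ℕ} {p : Fin (numCoords k) → F} {x : Vertex k F}
    (h : (D k F).Adj (Sum.inl p) x) : ∃ l, x = Sum.inr l ∧ Incident p l := by
  obtain x | x := x
  · exact h.elim
  · exact ⟨x, rfl, h⟩

theorem adj_inr {k : ℕ} {l : Fin (numCoords k) → F} {x : Vertex k F}
    (h : (D k F).Adj (Sum.inr l) x) : ∃ p, x = Sum.inl p ∧ Incident p l := by
  obtain x | x := x
  · exact ⟨x, rfl, h⟩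
  · exact h.elim

/-- At distance at most `i` from the zero point, the chain coordinates from the `(i + 1)`-st on
vanish. -/
theorem chain_eq_zero_of_walk_from_zero_point {k N : ℕ} {u : ℕ → Vertex k F} (h0 : u 0 = Sum.inl 0)
    (hu : ∀ i < N, (D k F).Adj (u i) (u (i + 1))) (i : ℕ) (hi : i ≤ N) :
    (Even i → ∃ p, u i = Sum.inl p ∧
      ∀ j, i + 1 ≤ j → 2 * j < numCoords k + 4 → chain (extend p) j = 0) ∧
    (Odd i → ∃ l, u i = Sum.inr l ∧
      ∀ j, i + 1 ≤ j → 2 * j < numCoords k + 4 → chain (extend l) j = 0) := by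
  have hn := two_le_numCoords k
  induction i with
  | zero =>
    refine ⟨fun _ => ⟨0, h0, fun j hj _ => ?_⟩, fun h => by simp at h⟩
    rw [extend_zero, chain_zero]
  | succ i ih =>
    obtain ⟨ih1, ih2⟩ := ih (by omega)
    have hadj := hu i (by omega)
    constructor
    · intro hi'
      obtain ⟨l, hl, hz⟩ := ih2 (by simpa [Nat.even_add_one] using hi')
      rw [hl] at hadj
      obtain ⟨p, hp, hinc⟩ := adj_inr hadj
      have hodd : ∀ j, i + 2 ≤ j → 2 * j < numCoords k + 4 → Odd j → chain (extend p) j = 0 := by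
        intro j hj hjn ho
        have := hinc.chain_odd ho (by omega) hjn
        rw [hz j (by omega) hjn, hz (j - 1) (by omega) (by omega)] at this
        linear_combination -this
      refine ⟨p, hp, fun j hj hjn => ?_⟩
      rcases Nat.even_or_odd j with he | ho
      · have := hinc.chain_even he (by omega) hjn hn
        have hij : j ≠ i + 2 := by
          rintro rfl
          exact absurd he (by simpa [Nat.even_add_one] using hi')
        rw [hz j (by omega) hjn, hodd (j - 1) (by omega) (by omega)
          (Nat.Even.sub_odd (by omega) he odd_one)] at this
        linear_combination -this
      · exact hodd j hj hjn ho
    · intro hi'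
      obtain ⟨p, hp, hz⟩ := ih1 (by simpa [Nat.odd_add_one] using hi')
      rw [hp] at hadj
      obtain ⟨l, hl, hinc⟩ := adj_inl hadj
      have heven : ∀ j, i + 2 ≤ j → 2 * j < numCoords k + 4 → Even j → chain (extend l) j = 0 := by
        intro j hj hjn he
        have := hinc.chain_even he (by omega) hjn hn
        rw [hz j (by omega) hjn, hz (j - 1) (by omega) (by omega)] at this
        linear_combination this
      refine ⟨l, hl, fun j hj hjn => ?_⟩
      rcases Nat.even_or_odd j with he | ho
      · exact heven j hj hjn he
      · have := hinc.chain_odd ho (by omega) hjn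
        have hij : j ≠ i + 2 := by
          rintro rfl
          simp [Nat.odd_add_one] at hi' ho
          exact absurd ho (Nat.not_odd_iff_even.2 hi')
        rw [hz j (by omega) hjn, heven (j - 1) (by omega) (by omega)
          (Nat.Odd.sub_odd ho odd_one)] at this
        linear_combination this

/-- After `i + 1` steps without backtracking from the zero line, avoiding the zero point, the
`(i + 1)`-st chain coordinate is nonzero: each step multiplies it by a difference of first
coordinates of two neighbours of the same vertex. The induction needs the exact value of the next
chain coordinate and the vanishing of all later ones as well. -/
theorem chain_ne_zero_of_walk_from_zero_line {k N : ℕ} {v : ℕ → Vertex k F} (h0 : v 0 = Sum.inr 0)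
    (hv : ∀ i < N, (D k F).Adj (v i) (v (i + 1))) (hne1 : v 1 ≠ Sum.inl 0)
    (hne : ∀ i, i + 2 ≤ N → v i ≠ v (i + 2)) (i : ℕ) (hi : i + 1 ≤ N)
    (hik : 2 * (i + 1) < numCoords k + 4) :
    (Even i → ∃ l p, v i = Sum.inr l ∧ v (i + 1) = Sum.inl p ∧ Incident p l ∧
      chain (extend p) (i + 1) ≠ 0 ∧
      (2 * (i + 2) < numCoords k + 4 →
        chain (extend p) (i + 2) = -extend l 0 * chain (extend p) (i + 1)) ∧
      ∀ j, i + 3 ≤ j → 2 * j < numCoords k + 4 → chain (extend p) j = 0) ∧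
    (Odd i → ∃ l p, v i = Sum.inl p ∧ v (i + 1) = Sum.inr l ∧ Incident p l ∧
      chain (extend l) (i + 1) ≠ 0 ∧
      (2 * (i + 2) < numCoords k + 4 →
        chain (extend l) (i + 2) = extend p 0 * chain (extend l) (i + 1)) ∧
      ∀ j, i + 3 ≤ j → 2 * j < numCoords k + 4 → chain (extend l) j = 0) := by
  have hn := two_le_numCoords k
  induction i with
  | zero =>
    refine ⟨fun _ => ?_, fun h => by simp at h⟩
    have hadj := hv 0 hi
    rw [h0] at hadj
    obtain ⟨p, hp, hinc⟩ := adj_inr hadj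
    have heven : ∀ j, 2 ≤ j → 2 * j < numCoords k + 4 → Even j → chain (extend p) j =
        0 := by
      intro j hj hjn he
      have := hinc.chain_even he hj hjn hn
      rw [extend_zero, chain_zero] at this
      simpa using this
    have hodd : ∀ j, 2 ≤ j → 2 * j < numCoords k + 4 → Odd j → chain (extend p) j =
        0 := by
      intro j hj hjn he
      have := hinc.chain_odd he hj hjn
      rw [extend_zero, chain_zero] at this
      simpa [chain_zero] using this
    have hz : ∀ j, 2 ≤ j → 2 * j < numCoords k + 4 → chain (extend p) j = 0 := fun j hj hjn =>
      (Nat.even_or_odd j).elim (heven j hj hjn) (hodd j hj hjn)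
    refine ⟨0, p, h0, hp, hinc, fun h => hne1 ?_, fun h => ?_, fun j hj => hz j (by omega)⟩
    · rw [hp]
      congr 1
      refine hinc.eq_of_fst_point hn (l := 0) ?_ ?_
      · intro m _ _
        rw [extend_zero]
        rcases m with _ | _ | _ | _ | m
        · simp [rhs]
        · simp [rhs]
        · simp [rhs]
        · simp [rhs]
        · simp only [rhs]
          split <;> simp
      · rw [extend_zero]; exact h
    · rw [hz 2 le_rfl h, extend_zero]; simp
  | succ i ih =>
    obtain ⟨ih1, ih2⟩ := ih (by omega) (by omega)
    have hadj := hv (i + 1) (by omega)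
    constructor
    · intro hi'
      have hio : Odd i := by simpa [Nat.even_add_one] using hi'
      obtain ⟨l, p, hp, hl, hinc, hnz, hnext, hz⟩ := ih2 hio
      rw [hl] at hadj
      obtain ⟨p', hp', hinc'⟩ := adj_inr hadj
      have hpp : extend p 0 ≠ extend p' 0 := by
        intro he
        refine hne i (by omega) ?_
        rw [hp, hp', hinc.eq_of_fst_point hn hinc' he]
      have h1 : chain (extend p') (i + 2) =
          (extend p 0 - extend p' 0) * chain (extend l) (i + 1) := by
        have := hinc'.chain_odd (j := i + 2) (by simpa [Nat.odd_add_one] using hio) (by omega) hik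
        rw [hnext hik, show i + 2 - 1 = i + 1 by omega] at this
        linear_combination -this
      have h2 : 2 * (i + 3) < numCoords k + 4 → chain (extend p') (i + 3) =
          -extend l 0 * chain (extend p') (i + 2) := by
        intro h
        have := hinc'.chain_even (j := i + 3)
          (by simpa [Nat.even_add_one] using hio) (by omega) h hn
        rw [hz (i + 3) le_rfl h, show i + 3 - 1 = i + 2 by omega] at this
        linear_combination -this
      have hodd : ∀ j, i + 4 ≤ j → 2 * j < numCoords k + 4 → Odd j → chain (extend p') j = 0 := by
        intro j hj hjn ho
        have := hinc'.chain_odd ho (by omega) hjn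
        rw [hz j (by omega) hjn, hz (j - 1) (by omega) (by omega)] at this
        linear_combination -this
      refine ⟨l, p', hl, hp', hinc', ?_, h2, ?_⟩
      · rw [h1]
        exact mul_ne_zero (sub_ne_zero.2 hpp) hnz
      · intro j hj hjn
        rcases Nat.even_or_odd j with he | ho
        · have hij : j ≠ i + 4 := by
            rintro rfl
            simp [Nat.even_add_one] at he
            exact absurd he (Nat.not_even_iff_odd.2 hio)
          have := hinc'.chain_even he (by omega) hjn hn
          rw [hz j (by omega) hjn, hodd (j - 1) (by omega) (by omega)
            (Nat.Even.sub_odd (by omega) he odd_one)] at this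
          linear_combination -this
        · exact hodd j hj hjn ho
    · intro hi'
      have hie : Even i := by simpa [Nat.odd_add_one] using hi'
      obtain ⟨l, p, hl, hp, hinc, hnz, hnext, hz⟩ := ih1 hie
      rw [hp] at hadj
      obtain ⟨l', hl', hinc'⟩ := adj_inl hadj
      have hll : extend l 0 ≠ extend l' 0 := by
        intro he
        refine hne i (by omega) ?_
        rw [hl, hl', hinc.eq_of_fst_line hn hinc' he]
      have h1 : chain (extend l') (i + 2) =
          (extend l' 0 - extend l 0) * chain (extend p) (i + 1) := by
        have := hinc'.chain_even (j := i + 2) (by simpa [Nat.even_add_one] using hie)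
          (by omega) hik hn
        rw [hnext hik, show i + 2 - 1 = i + 1 by omega] at this
        linear_combination this
      have h2 : 2 * (i + 3) < numCoords k + 4 → chain (extend l') (i + 3) =
          extend p 0 * chain (extend l') (i + 2) := by
        intro h
        have := hinc'.chain_odd (j := i + 3)
          (by simpa [Nat.odd_add_one] using hie) (by omega) h
        rw [hz (i + 3) le_rfl h, show i + 3 - 1 = i + 2 by omega] at this
        linear_combination this
      have heven : ∀ j, i + 4 ≤ j → 2 * j < numCoords k + 4 → Even j → chain (extend l') j = 0 := by
        intro j hj hjn ho
        have := hinc'.chain_even ho (by omega) hjn hn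
        rw [hz j (by omega) hjn, hz (j - 1) (by omega) (by omega)] at this
        linear_combination this
      refine ⟨l', p, hp, hl', hinc', ?_, h2, ?_⟩
      · rw [h1]
        exact mul_ne_zero (sub_ne_zero.2 hll.symm) hnz
      · intro j hj hjn
        rcases Nat.even_or_odd j with he | ho
        · exact heven j hj hjn he
        · have hij : j ≠ i + 4 := by
            rintro rfl
            simp [Nat.odd_add_one] at ho
            exact absurd hie (Nat.not_even_iff_odd.2 ho)
          have := hinc'.chain_odd ho (by omega) hjn
          rw [hz j (by omega) hjn, heven (j - 1) (by omega) (by omega)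
            (Nat.Odd.sub_odd ho odd_one)] at this
          linear_combination this

/-! ### Lower bound for the girth -/

/-- A walk of `m` steps from the line of a flag that does not backtrack and leaves the flag, and a
walk of `m - 1` steps from its point, end in different vertices: after moving the flag to the zero
flag, the `m`-th chain coordinate separates them. -/
theorem ne_of_walks_from_flag {k m : ℕ} (hm : 2 ≤ m) (hmk : 2 * m < numCoords k + 4)
    {v u : ℕ → Vertex k F} {p l : Fin (numCoords k) → F} (hv0 : v 0 = Sum.inr l)
    (hu0 : u 0 = Sum.inl p) (h : Incident p l)
    (hv : ∀ i < m, (D k F).Adj (v i) (v (i + 1)))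
    (hu : ∀ i < m - 1, (D k F).Adj (u i) (u (i + 1))) (hne1 : v 1 ≠ u 0)
    (hne : ∀ i, i + 2 ≤ m → v i ≠ v (i + 2)) : v m ≠ u (m - 1) := by
  obtain ⟨φ, hp, hl⟩ := exists_iso_zero h
  intro heq
  obtain ⟨h1, h2⟩ := chain_ne_zero_of_walk_from_zero_line (N := m) (v := fun i => φ (v i))
    (by rw [hv0, hl]) (fun i hi => φ.map_adj_iff.2 (hv i hi))
    (fun h => hne1 (φ.injective (by rw [h, hu0, hp])))
    (fun i hi h => hne i hi (φ.injective h)) (m - 1) (by omega) (by omega)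
  obtain ⟨h3, h4⟩ := chain_eq_zero_of_walk_from_zero_point (N := m - 1) (u := fun i => φ (u i))
    (by rw [hu0, hp]) (fun i hi => φ.map_adj_iff.2 (hu i hi)) (m - 1) le_rfl
  have hm1 : m - 1 + 1 = m := by omega
  rw [hm1] at h1 h2 h3 h4
  rcases Nat.even_or_odd (m - 1) with he | ho
  · obtain ⟨l', p', -, hp', -, hnz, -⟩ := h1 he
    obtain ⟨p'', hp'', hz⟩ := h3 he
    have : p' = p'' := Sum.inl_injective (hp'.symm.trans ((congrArg φ heq).trans hp''))
    exact hnz (this ▸ hz m le_rfl hmk)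
  · obtain ⟨l', p', -, hl', -, hnz, -⟩ := h2 ho
    obtain ⟨l'', hl'', hz⟩ := h4 ho
    have : l' = l'' := Sum.inr_injective (hl'.symm.trans ((congrArg φ heq).trans hl''))
    exact hnz (this ▸ hz m le_rfl hmk)

theorem isBipartite_D (k : ℕ) : (D k F).IsBipartite := by
  refine ⟨SimpleGraph.Coloring.mk (fun x => if x.isLeft then 0 else 1) ?_⟩
  rintro (x | x) (y | y) h
  · exact h.elim
  · simp
  · simp
  · exact h.elim

theorem numCoords_add_four_le_length {k : ℕ} {x : Vertex k F} {w : (D k F).Walk x x}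
    (hw : w.IsCycle) : numCoords k + 4 ≤ w.length := by
  by_contra! hlt
  -- A cycle of length `2 * m` is an edge with two walks of `m` and `m - 1` steps that meet.
  obtain ⟨m, hm⟩ := SimpleGraph.two_colorable_iff_forall_loop_even.1 (isBipartite_D k) x w
  have h3 := hw.three_le_length
  have hadj : ∀ i < w.length, (D k F).Adj (w.getVert i) (w.getVert (i + 1)) :=
    fun i hi => w.adj_getVert_succ hi
  have hinj : ∀ i j, i < j → j ≤ w.length → 0 < i → w.getVert i ≠ w.getVert j :=
    fun i j hij hj hi h => hij.ne (hw.getVert_injOn ⟨by omega, by omega⟩ ⟨by omega, by omega⟩ h)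
  have hinj' : ∀ i j, i < j → j < w.length → w.getVert i ≠ w.getVert j :=
    fun i j hij hj h => hij.ne (hw.getVert_injOn' (by simp; omega) (by simp; omega) h)
  have hlast : w.getVert w.length = x := w.getVert_length
  have hfirst : w.getVert 0 = x := w.getVert_zero
  obtain x | x := x
  · obtain ⟨l, hl, hinc⟩ := adj_inl (hfirst ▸ hadj 0 (by omega))
    refine ne_of_walks_from_flag (m := m) (by omega) (by omega) (v := fun i => w.getVert (i + 1))
      (u := fun i => w.getVert (w.length - i)) hl (by simp) hinc
      (fun i hi => hadj _ (by omega)) ?_ ?_ ?_ ?_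
    · intro i hi
      have := (hadj (w.length - (i + 1)) (by omega)).symm
      rwa [show w.length - (i + 1) + 1 = w.length - i by omega] at this
    · simp only [Nat.sub_zero]
      exact hinj _ _ (by omega) (by omega) (by omega)
    · exact fun i hi => hinj _ _ (by omega) (by omega) (by omega)
    · congr 1
      omega
  · have hadj' := (hadj (w.length - 1) (by omega)).symm
    rw [show w.length - 1 + 1 = w.length by omega, hlast] at hadj'
    obtain ⟨p, hp, hinc⟩ := adj_inr hadj'
    refine ne_of_walks_from_flag (m := m) (by omega) (by omega) (v := fun i => w.getVert i)
      (u := fun i => w.getVert (w.length - 1 - i)) hfirst hp hinc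
      (fun i hi => hadj _ (by omega)) ?_ ?_ ?_ ?_
    · intro i hi
      have := (hadj (w.length - 1 - (i + 1)) (by omega)).symm
      rwa [show w.length - 1 - (i + 1) + 1 = w.length - 1 - i by omega] at this
    · exact hinj' _ _ (by omega) (by omega)
    · exact fun i hi => hinj' _ _ (by omega) (by omega)
    · congr 1
      omega

theorem le_length_of_isCycle_of_odd {k : ℕ} (hk : Odd k) {x : Vertex k F}
    {w : (D k F).Walk x x} (hw : w.IsCycle) : k + 5 ≤ w.length := by
  obtain ⟨m, hm⟩ := SimpleGraph.two_colorable_iff_forall_loop_even.1 (isBipartite_D k) x w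
  have h := numCoords_add_four_le_length hw
  have h1 : numCoords k = max k 2 := rfl
  obtain ⟨j, rfl⟩ := hk
  omega

theorem le_length_of_isCycle_CD {k : ℕ} (hk : Odd k) (C : (D k F).ConnectedComponent) {x : C}
    {w : (CD C).Walk x x} (hw : w.IsCycle) : k + 5 ≤ w.length := by
  have := le_length_of_isCycle_of_odd hk (hw.map (f := C.toSimpleGraph_hom) Subtype.val_injective)
  rwa [SimpleGraph.Walk.length_map] at this

theorem two_mul_size {k : ℕ} [Finite F] (C : (D k F).ConnectedComponent) :
    2 * size (CD C) = order (CD C) * Nat.card F := by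
  classical
  have := Fintype.ofFinite C
  have h := (CD C).sum_degrees_eq_twice_card_edges
  have hd : ∀ x, (CD C).degree x = Nat.card F := fun x => by
    rw [← card_neighborSet_CD C x, Nat.card_eq_fintype_card, SimpleGraph.card_neighborSet_eq_degree]
  rw [Finset.sum_congr rfl fun x _ => hd x] at h
  rw [size, order, Nat.card_eq_fintype_card, Nat.card_eq_fintype_card (α := C),
    ← SimpleGraph.edgeFinset_card, ← h]
  simp

theorem not_isAcyclic_CD {k : ℕ} [Finite F] (C : (D k F).ConnectedComponent) :
    ¬ (CD C).IsAcyclic := by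
  classical
  intro h
  have := Fintype.ofFinite C
  have ht : (CD C).IsTree := ⟨C.connected_toSimpleGraph, h⟩
  have h1 := ht.card_edgeFinset
  have h2 := two_mul_size C
  rw [size, order, Nat.card_eq_fintype_card, Nat.card_eq_fintype_card (α := C),
    ← SimpleGraph.edgeFinset_card, ← h1] at h2
  have h3 : 2 ≤ Nat.card F := Finite.one_lt_card
  nlinarith

theorem le_girth_CD {k : ℕ} [Finite F] (hk : Odd k) (C : (D k F).ConnectedComponent) :
    k + 5 ≤ (CD C).girth := by
  obtain ⟨a, w, hw, h⟩ := SimpleGraph.exists_girth_eq_length.2 (not_isAcyclic_CD C)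
  rw [h]
  exact le_length_of_isCycle_CD hk C hw

/-! ### A cycle of length `2 * m` from an element of order `m` -/

theorem rescale_C_eq (a x : F) : rescale a (C x) = C x := by
  ext j
  rcases j with _ | j <;> simp [coeff_C]

/-- The automorphism of the matrix ring that multiplies both parameters `x` of `Up x` and `Lo x`
by `ω`: the substitution `X ↦ ω ^ 2 X` followed by conjugation with `diag(ω, 1)`. -/
noncomputable def twist (ω : F) (M : Matrix (Fin 2) (Fin 2) F⟦X⟧) : Matrix (Fin 2) (Fin 2) F⟦X⟧ :=
  !![rescale (ω ^ 2) (M 0 0), C ω * rescale (ω ^ 2) (M 0 1);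
     C ω⁻¹ * rescale (ω ^ 2) (M 1 0), rescale (ω ^ 2) (M 1 1)]

theorem twist_mul {ω : F} (hω : ω ≠ 0) (M N : Matrix (Fin 2) (Fin 2) F⟦X⟧) :
    twist ω (M * N) = twist ω M * twist ω N := by
  have h : (C ω : F⟦X⟧) * C ω⁻¹ = 1 := by rw [← map_mul, mul_inv_cancel₀ hω, map_one]
  ext1 i j
  fin_cases i <;> fin_cases j <;>
    simp only [twist, Matrix.mul_apply, Fin.sum_univ_two, map_add, map_mul] <;> simp
  · linear_combination -(rescale (ω ^ 2) (M 0 1)) * (rescale (ω ^ 2) (N 1 0)) * h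
  · ring
  · ring
  · linear_combination -(rescale (ω ^ 2) (M 1 0)) * (rescale (ω ^ 2) (N 0 1)) * h

theorem twist_Up (ω x : F) : twist ω (Up x) = Up (ω * x) := by
  ext1 i j
  fin_cases i <;> fin_cases j <;> simp [twist, Up, rescale_C_eq]

theorem twist_Lo {ω : F} (hω : ω ≠ 0) (y : F) : twist ω (Lo y) = Lo (ω * y) := by
  ext1 i j
  fin_cases i <;> fin_cases j <;> simp [twist, Lo, rescale_C_eq]
  have h : (C ω : F⟦X⟧) * C ω⁻¹ = 1 := by rw [← map_mul, mul_inv_cancel₀ hω, map_one]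
  linear_combination C ω * C y * X * h

/-- The product `Up 1 * Lo 1 * Up ω * Lo ω * Up (ω ^ 2) * Lo (ω ^ 2) * ⋯` with `2 * i` factors. -/
noncomputable def word (ω : F) : ℕ → Matrix (Fin 2) (Fin 2) F⟦X⟧
  | 0 => 1
  | i + 1 => word ω i * (Up (ω ^ i) * Lo (ω ^ i))

theorem twist_one {ω : F} : twist ω 1 = 1 := by
  rw [← Up_zero, twist_Up, mul_zero]

theorem mul_twist_word {ω : F} (hω : ω ≠ 0) (i : ℕ) :
    Up 1 * Lo 1 * twist ω (word ω i) = word ω (i + 1) := by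
  induction i with
  | zero => simp [word, twist_one]
  | succ i ih =>
    rw [word, twist_mul hω, ← mul_assoc, ih, twist_mul hω, twist_Up, twist_Lo hω, ← pow_succ',
      word.eq_2 ω (i + 1)]

/-- Twisting the word and prefixing its first two factors gives the word with the factors for
`ω ^ m = 1` appended, so that the twisted word is a conjugate of the word. -/
theorem twist_word_eq {ω : F} {m : ℕ} (hm : 0 < m) (hω : ω ^ m = 1) :
    Up 1 * Lo 1 * twist ω (word ω m) = word ω m * (Up 1 * Lo 1) := by
  have h0 : ω ≠ 0 := by
    rintro rfl
    simp [hm.ne'] at hω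
  rw [mul_twist_word h0, word, hω]

theorem isFlag_word (ω : F) (i : ℕ) : IsFlag 1 (word ω i) := by
  induction i with
  | zero => rw [word, ← Up_zero]; exact isFlag_Up 0
  | succ i ih => rw [word, ← mul_assoc]; exact (ih.mul_Up _).mul_Lo _

/-- If `ω` has order `m`, the word of length `2 * m` is trivial in low degrees. With the grading in
which the degree `j` coefficients of the entries `a, b, c, d` have weight `2 * j`, `2 * j + 1`, `2
* j - 1`, `2 * j`, the twist multiplies the part of weight `e` by `ω ^ e`. By `twist_word_eq`, the
lowest nonzero part of `word ω m - 1` is fixed by the twist, so its (positive) weight is at least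
`m`. -/
theorem word_cong_one {ω : F} {m n : ℕ} (hω : orderOf ω = m) (hm : 0 < m)
    (hn : n + 4 ≤ 2 * m) : Cong n (word ω m) 1 := by
  have hωm : ω ^ m = 1 := hω ▸ pow_orderOf_eq_one ω
  have h0 : ω ≠ 0 := by
    rintro rfl
    simp [hm.ne'] at hωm
  have key : ∀ e, 0 < e → e < m → ω ^ e ≠ 1 := fun e he hem h => by
    have := orderOf_le_of_pow_eq_one he h
    omega
  have cancel : ∀ {e : ℕ} {x : F}, 0 < e → e < m → ω ^ e * x = x → x = 0 := by
    intro e x he hem h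
    have : (ω ^ e - 1) * x = 0 := by linear_combination h
    exact (mul_eq_zero.1 this).resolve_left (sub_ne_zero.2 (key e he hem))
  set V := word ω m - 1 with hV
  have hVe : Up 1 * Lo 1 * twist ω V = V * (Up 1 * Lo 1) := by
    have hsub : twist ω V = twist ω (word ω m) - twist ω 1 := by
      ext1 i j
      fin_cases i <;> fin_cases j <;> simp [twist, V]
    rw [hsub, mul_sub, twist_word_eq hm hωm, twist_one, hV, sub_mul, one_mul, mul_one]
  have hUL : (Up 1 * Lo 1 : Matrix (Fin 2) (Fin 2) F⟦X⟧) = !![1 + X, 1; X, 1] := by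
    simp [Up, Lo]
  rw [hUL] at hVe
  have E00 := congrFun (congrFun hVe 0) 0
  have E01 := congrFun (congrFun hVe 0) 1
  have E10 := congrFun (congrFun hVe 1) 0
  have E11 := congrFun (congrFun hVe 1) 1
  simp only [Matrix.mul_apply, Fin.sum_univ_two, twist] at E00 E01 E10 E11
  simp at E00 E01 E10 E11
  have ha0 : coeff 0 (V 0 0) = 0 := by
    rw [hV, Matrix.sub_apply, map_sub, (isFlag_word ω m).a0]; simp
  have hc0 : coeff 0 (V 1 0) = 0 := by
    rw [hV, Matrix.sub_apply, map_sub, (isFlag_word ω m).c0]; simp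
  have hd0 : coeff 0 (V 1 1) = 0 := by
    rw [hV, Matrix.sub_apply, map_sub, (isFlag_word ω m).d0]; simp
  have hall : ∀ j, (2 * j ≤ m → coeff j (V 1 0) = 0) ∧ (2 * j < m → coeff j (V 0 0) = 0) ∧
      (2 * j < m → coeff j (V 1 1) = 0) ∧ (2 * j + 1 < m → coeff j (V 0 1) = 0) := by
    intro j
    induction j with
    | zero =>
      refine ⟨fun _ => hc0, fun _ => ha0, fun _ => hd0, fun h => ?_⟩
      have := congrArg (coeff 0) E01
      simp only [map_add, coeff_zero_mul', coeff_rescale, pow_zero, one_mul, coeff_zero_C,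
        coeff_zero_X, coeff_zero_one, add_zero, ha0, hd0] at this
      refine cancel (e := 1) one_pos (by omega) ?_
      rw [pow_one]
      linear_combination this
    | succ j ih =>
      obtain ⟨ihc, iha, ihd, ihb⟩ := ih
      have hC : 2 * (j + 1) ≤ m → coeff (j + 1) (V 1 0) = 0 := by
        intro h
        have := congrArg (coeff (j + 1)) E10
        simp [mul_add, coeff_succ_X_mul, coeff_succ_mul_X] at this
        rw [iha (by omega), ihd (by omega), ihc (by omega)] at this
        refine cancel (e := 2 * j + 1) (by omega) (by omega) ?_
        rw [show ω ^ (2 * j + 1) = ω⁻¹ * (ω ^ 2) ^ (j + 1) by field_simp; ring]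
        linear_combination this
      have hA : 2 * (j + 1) < m → coeff (j + 1) (V 0 0) = 0 := by
        intro h
        have := congrArg (coeff (j + 1)) E00
        simp [add_mul, mul_add, coeff_succ_X_mul, coeff_succ_mul_X] at this
        rw [iha (by omega), ihb (by omega), hC (by omega)] at this
        refine cancel (e := 2 * (j + 1)) (by omega) (by omega) ?_
        rw [pow_mul]
        linear_combination this
      have hD : 2 * (j + 1) < m → coeff (j + 1) (V 1 1) = 0 := by
        intro h
        have := congrArg (coeff (j + 1)) E11
        simp [coeff_succ_X_mul] at this
        rw [ihb (by omega), hC (by omega)] at this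
        refine cancel (e := 2 * (j + 1)) (by omega) (by omega) ?_
        rw [pow_mul]
        linear_combination this
      refine ⟨hC, hA, hD, fun h => ?_⟩
      have := congrArg (coeff (j + 1)) E01
      simp [add_mul, coeff_succ_X_mul] at this
      rw [ihb (by omega), hA (by omega), hD (by omega)] at this
      refine cancel (e := 2 * (j + 1) + 1) (by omega) (by omega) ?_
      rw [pow_succ, pow_mul]
      linear_combination this
  refine ⟨fun j hj => (hall j).2.1 (by omega), fun j hj => (hall j).2.2.2 (by omega),
    fun j hj => (hall j).1 (by omega), fun j hj => (hall j).2.2.1 (by omega)⟩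

theorem coeff_word_zero_one (ω : F) (i : ℕ) :
    coeff 0 (word ω i 0 1) = ∑ j ∈ Finset.range i, ω ^ j := by
  induction i with
  | zero => simp [word]
  | succ i ih =>
    rw [Finset.sum_range_succ, ← ih, word, ← mul_assoc, ← (isFlag_word ω i).coeff_mul_Up]
    simp [Matrix.mul_apply, Fin.sum_univ_two, Lo]

theorem coeff_word_one_zero (ω : F) (i : ℕ) :
    coeff 1 (word ω i 1 0) = ∑ j ∈ Finset.range i, ω ^ j := by
  induction i with
  | zero => simp [word]
  | succ i ih =>
    rw [Finset.sum_range_succ, word, ← mul_assoc, ((isFlag_word ω i).mul_Up _).coeff_mul_Lo,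
      mul_one, ← ih]
    simp [Matrix.mul_apply, Fin.sum_univ_two, Up]

/-- The flags of the closed polygon, two steps apart. -/
noncomputable def polygonMat (ω : F) (i : ℕ) : Matrix (Fin 2) (Fin 2) F⟦X⟧ :=
  baseMat * word ω i

/-- A closed polygon with `2 * m` sides whose points and lines have the partial geometric sums of
`ω` as first coordinates, up to sign. -/
theorem exists_closed_polygon {ω : F} {m n : ℕ} (hn : 2 ≤ n) (hω : orderOf ω = m) (hm : 2 ≤ m)
    (hnm : n + 4 ≤ 2 * m) : ∃ P L : ℕ → Fin n → F, (∀ i, Incident (P i) (L i)) ∧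
      (∀ i, Incident (P (i + 1)) (L i)) ∧ P m = P 0 ∧
      (∀ i, extend (P i) 0 = -∑ j ∈ Finset.range i, ω ^ j) ∧
      ∀ i, extend (L i) 0 = ∑ j ∈ Finset.range (i + 1), ω ^ j := by
  have hG : ∀ i, IsFlag (-1) (polygonMat ω i) := fun i => by
    simpa [polygonMat] using isFlag_baseMat.mul (isFlag_word ω i)
  have hb : ∀ i, coeff 0 ((polygonMat ω i) 0 1) = ∑ j ∈ Finset.range i, ω ^ j := fun i => by
    rw [← coeff_word_zero_one]
    simp [polygonMat, Matrix.mul_apply, Fin.sum_univ_two, baseMat]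
  have hc : ∀ i, coeff 1 ((polygonMat ω i) 1 0) = -∑ j ∈ Finset.range i, ω ^ j := fun i => by
    rw [← coeff_word_one_zero]
    simp [polygonMat, Matrix.mul_apply, Fin.sum_univ_two, baseMat]
  choose P hP using fun i => exists_ptMat hn (hG i)
  choose L hL using fun i => exists_lnMat hn ((hG i).mul_Up (ω ^ i))
  have hsucc : ∀ i, polygonMat ω (i + 1) =
      polygonMat ω i * Up (ω ^ i) * Lo (ω ^ i) := fun i => by
    simp only [polygonMat, word, mul_assoc]
  have hL' : ∀ i, ∃ y, Cong n (lnMat (L i) * Lo y) (polygonMat ω i * Up (ω ^ i)) := fun i => by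
    refine ⟨-coeff 1 ((polygonMat ω i * Up (ω ^ i)) 1 0), ?_⟩
    have := (hL i).mul_right (coeff_Lo (-coeff 1 ((polygonMat ω i * Up (ω ^ i)) 1 0)))
    rwa [mul_assoc _ (Lo _) (Lo _), Lo_mul_Lo, add_neg_cancel, Lo_zero, mul_one] at this
  have hP' : ∀ i x, ∃ y, Cong n (ptMat (P i) * Up y) (polygonMat ω i * Up x) := fun i x => by
    refine ⟨coeff 0 ((polygonMat ω i) 0 1) + x, ?_⟩
    have := (hP i).mul_right (coeff_Up (coeff 0 ((polygonMat ω i) 0 1) + x))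
    rwa [mul_assoc _ (Up _) (Up _), Up_mul_Up, neg_add_cancel_left] at this
  refine ⟨P, L, fun i => ?_, fun i => ?_, ?_, fun i => ?_, fun i => ?_⟩
  · obtain ⟨y, hy⟩ := hL' i
    obtain ⟨x, hx⟩ := hP' i (ω ^ i)
    exact incident_of_cong hn (hy.trans hx.symm)
  · obtain ⟨y, hy⟩ := hL' i
    obtain ⟨x, hx⟩ := hP' (i + 1) 0
    have h1 := hy.mul_right (coeff_Lo (ω ^ i))
    rw [← hsucc, mul_assoc, Lo_mul_Lo] at h1
    rw [Up_zero, mul_one] at hx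
    exact incident_of_cong hn (h1.trans hx.symm)
  · have h1 := (word_cong_one hω (by omega) hnm).mul_left (isFlag_baseMat (F := F)).c0
    have hs : coeff 0 ((polygonMat ω m) 0 1) = 0 := by
      rw [polygonMat, h1.coeff_zero_one]; simp [baseMat]
    have h2 := hP m
    have h3 := hP 0
    rw [hs, neg_zero, Up_zero, mul_one, polygonMat] at h2
    rw [hb, Finset.range_zero, Finset.sum_empty, neg_zero, Up_zero, mul_one, polygonMat, word] at h3
    exact ptMat_injective ((h2.trans h1).trans h3.symm)
  · have := (hP i).coeff_one_zero
    rw [coeff_ptMat_one_zero] at this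
    rw [this, ← hc]
    simp [Matrix.mul_apply, Fin.sum_univ_two, Up]
  · have := (hL i).coeff_zero_one
    rw [coeff_lnMat_zero_one] at this
    rw [this, Finset.sum_range_succ, ← hb, ← (hG i).coeff_mul_Up]
    simp [Matrix.mul_apply, Fin.sum_univ_two, Lo]

theorem pow_eq_pow_of_sum_eq {ω : F} {i j : ℕ}
    (h : ∑ a ∈ Finset.range i, ω ^ a = ∑ a ∈ Finset.range j, ω ^ a) : ω ^ i = ω ^ j := by
  have h1 := geom_sum_mul ω i
  rw [h, geom_sum_mul] at h1
  linear_combination -h1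

theorem exists_cycle_D {k m : ℕ} {ω : F} (hω : orderOf ω = m) (hm : 2 ≤ m)
    (hnm : numCoords k + 4 ≤ 2 * m) :
    ∃ (x : Vertex k F) (w : (D k F).Walk x x), w.IsCycle ∧ w.length = 2 * m := by
  obtain ⟨P, L, h1, h2, hm0, hP, hL⟩ := exists_closed_polygon (two_le_numCoords k) hω hm hnm
  rw [← SimpleGraph.cycleGraph_isContained_iff (by omega)]
  have hω0 : ω ≠ 0 := by
    rintro rfl
    have := orderOf_zero F
    omega
  -- The partial geometric sums determine the power of `ω`, so the vertices are distinct.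
  have hinj : ∀ {i j : ℕ}, i < m → j < m → ω ^ i = ω ^ j → i = j := fun hi hj h =>
    pow_injOn_Iio_orderOf (by simpa [hω] using hi) (by simpa [hω] using hj) h
  let f : Fin (2 * m) → Vertex k F := fun i =>
    if i.1 % 2 = 0 then Sum.inl (P (i.1 / 2)) else Sum.inr (L (i.1 / 2))
  have hstep : ∀ i j : Fin (2 * m), (j - i).1 = 1 → (D k F).Adj (f i) (f j) := by
    intro i j hij
    have hj : j.1 = i.1 + 1 ∨ (i.1 = 2 * m - 1 ∧ j.1 = 0) := by
      rw [Fin.sub_def] at hij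
      simp only at hij
      have hi := i.2
      have hj := j.2
      rcases Nat.lt_or_ge j.1 i.1 with h | h
      · rw [Nat.mod_eq_of_lt (by omega)] at hij; omega
      · rw [Nat.mod_eq_sub_mod (by omega), Nat.mod_eq_of_lt (by omega)] at hij; omega
    simp only [f]
    rcases Nat.mod_two_eq_zero_or_one i.1 with hi | hi
    · rw [if_pos hi, if_neg (by omega), show j.1 / 2 = i.1 / 2 by omega]
      exact h1 _
    · rw [if_neg (by omega), if_pos (by omega)]
      have : P (j.1 / 2) = P (i.1 / 2 + 1) := by
        rcases hj with hj | ⟨hi', hj⟩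
        · congr 1; omega
        · rw [hj, show i.1 / 2 + 1 = m by omega, hm0]
      rw [this]
      exact h2 _
  refine ⟨⟨⟨f, fun {i j} h => ?_⟩, fun i j h => ?_⟩⟩
  · rcases SimpleGraph.cycleGraph_adj'.1 h with h | h
    · exact (hstep _ _ h).symm
    · exact hstep _ _ h
  · have hi := i.2
    have hj := j.2
    change f i = f j at h
    simp only [f] at h
    ext
    split_ifs at h with h3 h4 h4
    · have := congrArg (fun x => extend x 0) (Sum.inl_injective h)
      simp only [hP, neg_inj] at this
      have := hinj (by omega) (by omega) (pow_eq_pow_of_sum_eq this)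
      omega
    · have := congrArg (fun x => extend x 0) (Sum.inr_injective h)
      simp only [hL] at this
      have h5 := pow_eq_pow_of_sum_eq this
      rw [pow_succ, pow_succ] at h5
      have := hinj (by omega) (by omega) (mul_right_cancel₀ hω0 h5)
      omega

theorem exists_orderOf_eq [Finite F] {m : ℕ} (h : Nat.card F ≡ 1 [MOD m]) :
    ∃ ω : F, orderOf ω = m := by
  have hq : 1 ≤ Nat.card F := Nat.card_pos
  have hdvd : m ∣ Nat.card Fˣ := by
    rw [Nat.card_units]
    exact (Nat.modEq_iff_dvd' hq).1 h.symm
  obtain ⟨g, hg⟩ := IsCyclic.exists_ofOrder_eq_natCard (α := Fˣ)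
  obtain ⟨d, hd⟩ := hdvd
  have hpos : 0 < Nat.card Fˣ := Nat.card_pos
  rw [hd] at hg hpos
  have hd0 : d ≠ 0 := by rintro rfl; simp at hpos
  refine ⟨((g ^ d : Fˣ) : F), ?_⟩
  rw [orderOf_units, orderOf_pow_of_dvd hd0 (by rw [hg]; exact dvd_mul_left _ _), hg,
    Nat.mul_div_cancel _ (Nat.pos_of_ne_zero hd0)]

theorem girth_CD_le {k m : ℕ} {ω : F} (hω : orderOf ω = m) (hm : 2 ≤ m)
    (hnm : numCoords k + 4 ≤ 2 * m) (C : (D k F).ConnectedComponent) :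
    (CD C).girth ≤ 2 * m := by
  obtain ⟨x, w, hw, hl⟩ := exists_cycle_D hω hm hnm
  set C₀ := (D k F).connectedComponentMk x
  have hC : ∀ y ∈ w.support, y ∈ C₀.supp := fun y hy =>
    by
    classical
    exact SimpleGraph.ConnectedComponent.sound ⟨(w.takeUntil y hy).reverse⟩
  have hcyc : (w.induce C₀.supp hC).IsCycle := by
    refine SimpleGraph.Walk.IsCycle.of_map (f := (SimpleGraph.Embedding.induce _).toHom) ?_
    rwa [SimpleGraph.Walk.map_induce]
  have hlen : (w.induce C₀.supp hC).length = 2 * m := by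
    have := congrArg SimpleGraph.Walk.length (SimpleGraph.Walk.map_induce w hC)
    rw [SimpleGraph.Walk.length_map] at this
    exact this.trans hl
  rw [← (nonempty_iso_CD C₀ C).some.girth_eq, ← hlen]
  exact SimpleGraph.girth_le_length hcyc

/-! ### The size, and conclusion -/

theorem rpow_identity {v N q : ℝ} (hv : 0 ≤ v) (hN : 0 ≤ N) (hq : 0 ≤ q)
    (hv' : v ≠ 0) {n : ℕ} (hn : n ≠ 0) (h : v * N = 2 * q ^ n) :
    v * q / 2 = (2 : ℝ) ^ (-1 - 1 / (n : ℝ)) * N ^ (1 / (n : ℝ)) * v ^ (1 + 1 / (n : ℝ)) := by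
  have h1 : N ^ (1 / (n : ℝ)) * v ^ (1 / (n : ℝ)) = 2 ^ (1 / (n : ℝ)) * q := by
    rw [← Real.mul_rpow hN hv, mul_comm N v, h, Real.mul_rpow zero_le_two (pow_nonneg hq n),
      one_div, Real.pow_rpow_inv_natCast hq hn]
  have h2 : (2 : ℝ) ^ (1 / (n : ℝ)) ≠ 0 := (Real.rpow_pos_of_pos two_pos _).ne'
  rw [Real.rpow_add (lt_of_le_of_ne hv hv'.symm), Real.rpow_one, Real.rpow_sub two_pos,
    Real.rpow_neg_one]
  calc v * q / 2 = 2⁻¹ / 2 ^ (1 / (n : ℝ)) * v * (2 ^ (1 / (n : ℝ)) * q) := by field_simp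
    _ = _ := by rw [← h1]; ring

end LazebnikUstimenko

open LazebnikUstimenko

theorem theorem3p2 (k t q : ℕ) (hk : 1 ≤ k) (ht : t = (k + 2) / 4)
    {F : Type*} [Field F] [Finite F] (hq : Nat.card F = q)
    (C : (LazebnikUstimenko.D k F).ConnectedComponent) (v e N : ℕ)
    (hv : v = LazebnikUstimenko.order (LazebnikUstimenko.CD C))
    (he : e = LazebnikUstimenko.size (LazebnikUstimenko.CD C))
    (hN : N = LazebnikUstimenko.numComponents k F) :
    -- (i) bipartite, connected, `q`-regular, order
    ((LazebnikUstimenko.CD C).IsBipartite ∧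
      (LazebnikUstimenko.CD C).Connected ∧
      (∀ x, Nat.card ((LazebnikUstimenko.CD C).neighborSet x) = q) ∧
      (v : ℝ) = 2 * (q : ℝ) ^ (max k 2) / (N : ℝ) ∧
      v ≤ 2 * q ^ (k - t + 1)) ∧
    -- (ii) transitivity on points, lines and edges
    (LazebnikUstimenko.AutTransitiveOn (LazebnikUstimenko.CD C) (LazebnikUstimenko.points C) ∧
      LazebnikUstimenko.AutTransitiveOn (LazebnikUstimenko.CD C) (LazebnikUstimenko.lines C) ∧
      LazebnikUstimenko.AutEdgeTransitive (LazebnikUstimenko.CD C)) ∧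
    -- (iii) girth (`SimpleGraph.girth` is `0` for a forest, so the bound includes that a cycle exists)
    (Odd k →
      k + 5 ≤ (LazebnikUstimenko.CD C).girth ∧
      (q ≡ 1 [MOD (k + 5) / 2] → (LazebnikUstimenko.CD C).girth = k + 5)) ∧
    -- (iv) size
    ((e : ℝ) = (v : ℝ) * q / 2 ∧
      (e : ℝ) = (2 : ℝ) ^ (-1 - 1 / ((max k 2 : ℕ) : ℝ)) * (N : ℝ) ^ (1 / ((max k 2 : ℕ) : ℝ)) *
        (v : ℝ) ^ (1 + 1 / ((max k 2 : ℕ) : ℝ))) := by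
  subst hq hv he hN
  have hqpos : 0 < Nat.card F := Nat.card_pos
  have hcard := order_mul_numComponents C
  have hsize := two_mul_size C
  have hle := le_numComponents (F := F) k
  have hpos : 0 < order (CD C) * numComponents k F := by rw [hcard]; positivity
  have hvpos := Nat.pos_of_mul_pos_right hpos
  have hNpos := Nat.pos_of_mul_pos_left hpos
  have hcardR : (order (CD C) : ℝ) * (numComponents k F : ℝ) =
      2 * (Nat.card F : ℝ) ^ (max k 2) := by exact_mod_cast hcard
  have hsizeR : (size (CD C) : ℝ) = (order (CD C) : ℝ) * (Nat.card F : ℝ) / 2 := by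
    have : (2 : ℝ) * size (CD C) = order (CD C) * Nat.card F := by exact_mod_cast hsize
    linarith
  refine ⟨⟨isBipartite_CD C, C.connected_toSimpleGraph, card_neighborSet_CD C, ?_, ?_⟩,
    ⟨autTransitiveOn_points C, autTransitiveOn_lines C, autEdgeTransitive_CD C⟩,
    fun hodd => ⟨le_girth_CD hodd C, fun hmod => ?_⟩, hsizeR, ?_⟩
  · rw [eq_div_iff (by positivity), hcardR]
  · refine le_of_mul_le_mul_right ?_ (pow_pos hqpos (t - 1))
    calc order (CD C) * Nat.card F ^ (t - 1) ≤ order (CD C) * numComponents k F :=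
          Nat.mul_le_mul_left _ (ht ▸ hle)
      _ = 2 * Nat.card F ^ (k - t + 1) * Nat.card F ^ (t - 1) := by
          have hexp : numCoords k = k - t + 1 + (t - 1) := by
            rw [numCoords]; omega
          rw [hcard, hexp, pow_add, mul_assoc]
  · obtain ⟨ω, hω⟩ := exists_orderOf_eq hmod
    have h1 : numCoords k = max k 2 := rfl
    obtain ⟨j, rfl⟩ := hodd
    refine le_antisymm ?_ (le_girth_CD ⟨j, rfl⟩ C)
    exact (girth_CD_le hω (by omega) (by omega) C).trans (by omega)
  · rw [hsizeR]
    exact rpow_identity (by positivity) (by positivity) (by positivity) (by positivity)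
      (by omega) hcardR
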